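/- Let $f=(f_1,\dots,f_n)$ be a vector field on $\mathbb R^n$ with $f_i\in\mathbb R[X]=\mathbb R[X_1,\dots,X_n]$, let $q_1,\dots,q_l\in\mathbb R[X]$, and let $K=\{x\in\mathbb R^n\mid q_i(x)\ge 0,\ i=1,\dots,l\}$. Let $G=[g_{kl}]$ be an $n\times n$ matrix with entries in $\mathbb R[X]$ that is a Riemannian metric on an open set $U\supseteq K$, i.e. $G(x)$ is symmetric and positive definite for every $x\in U$. Let $J=[\partial f_i/\partial x_j]$ be the Jacobian matrix of $f$, let $\dot G=[\sum_j f_j\,\partial_j g_{kl}]$ be the orbital derivative of $G$, and put $$\lambda_G'(x)=\max_{w^{\mathrm T}w=1,\ w^{\mathrm T}f(x)=0} w^{\mathrm T}\Big(J(x)G(x)-\tfrac12\dot G(x)\Big)w ,$$ where the maximum over the empty set (possible only for $n\le 1$) is $-\infty$. Write $\Sigma^2[X]$ and $\Sigma^2[X,W]$ for the sets of sums of squares of polynomials in $\mathbb R[X]$ and in $\mathbb R[X,W]=\mathbb R[X_1,\dots,X_n,W_1,\dots,W_n]$, and suppose that there is a $q$ in the quadratic module $$Q(q_1,\dots,q_l)=\Big\{s_0+\sum_{i=1}^l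 s_iq_i\ \Big|\ s_0,\dots,s_l\in\Sigma^2[X]\Big\}$$ such that $\{x\in\mathbb R^n\mid q(x)\ge 0\}$ is compact. Then the following two conditions are equivalent. 1. $\lambda_G'(x)<0$ for all $x\in K$. 2. There are a real $\epsilon>0$, polynomials $p_1,p_2\in\mathbb R[X,W]$ and $s_1,\dots,s_l\in\Sigma^2[X,W]$ such that $$-\epsilon-W^{\mathrm T}\Big(J(X)G(X)-\tfrac12\dot G(X)\Big)W-\sum_{i=1}^l s_i(X,W)\,q_i(X)+p_1(X,W)\,(|W|^2-1)+p_2(X,W)\,W^{\mathrm T}f(X)\in\Sigma^2[X,W].$$ -/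

import Mathlib

open scoped Matrix

namespace PolyContraction

noncomputable section

variable {n l : ℕ}

/-- The basic closed semialgebraic set `K = {x ∈ ℝⁿ | q_i(x) ≥ 0, i = 1, …, l}`. -/
def semialgSet (q : Fin l → MvPolynomial (Fin n) ℝ) : Set (Fin n → ℝ) :=
  {x | ∀ i, 0 ≤ MvPolynomial.eval x (q i)}

/-- The quadratic module `Q(q_1, …, q_l) = {s_0 + ∑ s_i q_i | s_0, …, s_l sums of squares}`
in `ℝ[X]`. -/
def quadraticModule (q : Fin l → MvPolynomial (Fin n) ℝ) : Set (MvPolynomial (Fin n) ℝ) :=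
  {p | ∃ (s₀ : MvPolynomial (Fin n) ℝ) (s : Fin l → MvPolynomial (Fin n) ℝ),
    IsSumSq s₀ ∧ (∀ i, IsSumSq (s i)) ∧ p = s₀ + ∑ i, s i * q i}

/-- The matrix `G(x)` of real numbers, for a matrix `G` of polynomials. -/
def evalMatrix (x : Fin n → ℝ) (M : Matrix (Fin n) (Fin n) (MvPolynomial (Fin n) ℝ)) :
    Matrix (Fin n) (Fin n) ℝ :=
  M.map (MvPolynomial.eval x)

/-- `G = [g_kl]`, with polynomial entries, is a Riemannian metric on `U`: the matrix `G(x)` is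
symmetric and positive definite at every point of `U` (`Matrix.PosDef` includes symmetry). -/
def IsRiemannianMetricOn (G : Matrix (Fin n) (Fin n) (MvPolynomial (Fin n) ℝ))
    (U : Set (Fin n → ℝ)) : Prop :=
  ∀ x ∈ U, (evalMatrix x G).PosDef

/-- The Jacobian matrix `J = [∂f_i / ∂x_j]` of the polynomial vector field `f`. -/
def jacobian (f : Fin n → MvPolynomial (Fin n) ℝ) :
    Matrix (Fin n) (Fin n) (MvPolynomial (Fin n) ℝ) :=
  Matrix.of fun i j => MvPolynomial.pderiv j (f i)

/-- The orbital derivative `Ġ = [∑_j f_j ∂_j g_kl]` of `G` along `f`. -/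
def orbitalDeriv (f : Fin n → MvPolynomial (Fin n) ℝ)
    (G : Matrix (Fin n) (Fin n) (MvPolynomial (Fin n) ℝ)) :
    Matrix (Fin n) (Fin n) (MvPolynomial (Fin n) ℝ) :=
  Matrix.of fun k m => ∑ j, f j * MvPolynomial.pderiv j (G k m)

/-- The matrix `J G - ½ Ġ`, with entries in `ℝ[X]`. -/
def contractionMatrix (f : Fin n → MvPolynomial (Fin n) ℝ)
    (G : Matrix (Fin n) (Fin n) (MvPolynomial (Fin n) ℝ)) :
    Matrix (Fin n) (Fin n) (MvPolynomial (Fin n) ℝ) :=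
  jacobian f * G - (1 / 2 : ℝ) • orbitalDeriv f G

/-- The compact set `{w ∈ ℝⁿ | wᵀ w = 1, wᵀ f(x) = 0}`. -/
def unitNormals (f : Fin n → MvPolynomial (Fin n) ℝ) (x : Fin n → ℝ) : Set (Fin n → ℝ) :=
  {w | w ⬝ᵥ w = 1 ∧ w ⬝ᵥ (fun i => MvPolynomial.eval x (f i)) = 0}

/-- `λ'_G(x) = max {wᵀ (J(x) G(x) - ½ Ġ(x)) w | wᵀ w = 1, wᵀ f(x) = 0}`. For `n ≥ 2` the set of
admissible `w` is compact and non-empty, so that the supremum is an attained real maximum; the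
values are extended reals in order that the maximum of the empty set, which occurs only for
`n ≤ 1`, is `-∞`. -/
def lambdaPrime (f : Fin n → MvPolynomial (Fin n) ℝ)
    (G : Matrix (Fin n) (Fin n) (MvPolynomial (Fin n) ℝ)) (x : Fin n → ℝ) : EReal :=
  ⨆ w ∈ unitNormals f x, ((w ⬝ᵥ (evalMatrix x (contractionMatrix f G) *ᵥ w) : ℝ) : EReal)

/-- `ℝ[X, W]`: the indeterminates `X_i` are indexed by `Sum.inl i`, the `W_i` by `Sum.inr i`. -/
abbrev PolyXW (n : ℕ) : Type := MvPolynomial (Fin n ⊕ Fin n) ℝ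

/-- The inclusion `ℝ[X] → ℝ[X, W]`. -/
def liftX : MvPolynomial (Fin n) ℝ →ₐ[ℝ] PolyXW n :=
  MvPolynomial.rename Sum.inl

/-- The vector `W = (W_1, …, W_n)` of indeterminates. -/
def vecW (n : ℕ) : Fin n → PolyXW n :=
  fun i => MvPolynomial.X (Sum.inr i)

/-- The polynomial
`-ε - Wᵀ (J G - ½ Ġ) W - ∑ s_i q_i + p₁ (|W|² - 1) + p₂ Wᵀ f` in `ℝ[X, W]`. -/
def certificate (f : Fin n → MvPolynomial (Fin n) ℝ)
    (G : Matrix (Fin n) (Fin n) (MvPolynomial (Fin n) ℝ))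
    (q : Fin l → MvPolynomial (Fin n) ℝ) (ε : ℝ) (p₁ p₂ : PolyXW n) (s : Fin l → PolyXW n) :
    PolyXW n :=
  - MvPolynomial.C ε - vecW n ⬝ᵥ ((contractionMatrix f G).map liftX *ᵥ vecW n)
    - ∑ i, s i * liftX (q i)
    + p₁ * (vecW n ⬝ᵥ vecW n - 1)
    + p₂ * (vecW n ⬝ᵥ fun i => liftX (f i))

end

end PolyContraction

/-! The certificate says that `-ε - Wᵀ(JG - ½Ġ)W` lies in the quadratic module `M` of `ℝ[X, W]`
generated by the `q_i` and by `±(|W|² - 1)`, `±Wᵀf`. The real points where `M` is non-negative are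
exactly the pairs `(x, w)` with `x ∈ K` and `w` a unit vector normal to `f(x)`. Evaluating the
certificate at such a point gives `λ'_G(x) ≤ -ε`. Conversely, these points form a compact set, so a
negative `λ'_G` bounds `-wᵀ(JG - ½Ġ)w` below by some `δ > 0`, and with `ε = δ/2` the polynomial is
strictly positive wherever `M` is non-negative. Jacobi's theorem
(`IsQuadraticModule.mem_of_forall_pos`) then puts it in `M`, provided that `M` is archimedean.

The archimedean property is the hard part. Since `1 - |W|²` is in `M`, it is enough to find `N` with
`N - |X|²` in `Q(q)`, where `{q ≥ 0}` is compact. For a single polynomial, `Q(q)` is a preordering,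
so Schmüdgen's theorem in Wörmann's form applies: the Positivstellensatz yields `(1 + t)(N - |X|²) ∈
Q(q)` with `t ∈ Q(q)`, and `exists_sub_sum_sq_mem` removes the factor.

The Positivstellensatz needed is `exists_real_point`. A proper preordering extends to an ordering,
whose residue field maps to an ordered field `E` with the intermediate value property for
polynomials (`exists_polyIVT_extension`, Artin–Schreier). The images of the variables are a solution
in `E`, and `exists_sameSign_mvPolynomial`, a transfer principle of Tarski type, moves it to `ℝ`.
Transfer in one variable is Hörmander's sign-table induction (`exists_diagram_signDetermined`);
further variables are added through ultrapowers. -/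

namespace PolyContraction

/-! ### Rolle and mean value theorems over ordered fields with polynomial intermediate values -/

section

open Polynomial

/-- Polynomials over the ordered field `K` have the intermediate value property. -/
class HasPolyIVT (K : Type*) [Field K] [LinearOrder K] : Prop where
  exists_root : ∀ (p : K[X]) (a b : K), a ≤ b → p.eval a ≤ 0 → 0 ≤ p.eval b →
    ∃ c, a ≤ c ∧ c ≤ b ∧ p.eval c = 0

section PolyIVT

variable {K : Type*} [Field K] [LinearOrder K] [IsStrictOrderedRing K] [HasPolyIVT K]

theorem exists_root_of_mul_nonpos (p : K[X]) {a b : K} (hab : a ≤ b)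
    (h : p.eval a * p.eval b ≤ 0) : ∃ c, a ≤ c ∧ c ≤ b ∧ p.eval c = 0 := by
  rcases mul_nonpos_iff.1 h with ⟨h1, h2⟩ | ⟨h1, h2⟩
  · obtain ⟨c, hc⟩ := HasPolyIVT.exists_root (-p) a b hab (by simpa) (by simpa)
    exact ⟨c, by simpa using hc⟩
  · exact HasPolyIVT.exists_root p a b hab h1 h2

theorem mul_pos_of_forall_ne_zero (p : K[X]) {a b : K} (hab : a ≤ b)
    (h : ∀ c, a ≤ c → c ≤ b → p.eval c ≠ 0) : 0 < p.eval a * p.eval b := by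
  by_contra! hn
  obtain ⟨c, h1, h2, h3⟩ := exists_root_of_mul_nonpos p hab hn
  exact h c h1 h2 h3

omit [HasPolyIVT K] in
theorem eq_zero_of_forall_Ioo {p : K[X]} {a b : K} (hab : a < b)
    (h : ∀ c, a < c → c < b → p.eval c = 0) : p = 0 :=
  Polynomial.eq_zero_of_infinite_isRoot p
    ((Set.Ioo_infinite hab).mono fun c hc => h c hc.1 hc.2)

/-- Write `p = (X - a)^(m+1) (X - b)^(n+1) s` with `s` of constant sign on `[a, b]`. Then `p' = (X -
a)^m (X - b)^n g`, where `g(a)` and `g(b)` have opposite signs, so `g` has a root strictly inside.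
No compactness is available over a general ordered field. -/
theorem exists_derivative_eq_zero_of_consecutive {p : K[X]} {a b : K} (hab : a < b) (hp : p ≠ 0)
    (ha : p.eval a = 0) (hb : p.eval b = 0) (hne : ∀ c, a < c → c < b → p.eval c ≠ 0) :
    ∃ c, a < c ∧ c < b ∧ (derivative p).eval c = 0 := by
  obtain ⟨r, hr, hra⟩ := exists_eq_pow_rootMultiplicity_mul_and_not_dvd p hp a
  have hm : p.rootMultiplicity a ≠ 0 := ((rootMultiplicity_pos hp).2 ha).ne'
  generalize p.rootMultiplicity a = m at hr hm
  have hr0 : r ≠ 0 := by rintro rfl; simp at hra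
  have hrb : r.eval b = 0 := by
    have := hb
    rw [hr] at this
    simpa [sub_ne_zero.2 hab.ne'] using this
  obtain ⟨s, hs, hsb⟩ := exists_eq_pow_rootMultiplicity_mul_and_not_dvd r hr0 b
  have hn : r.rootMultiplicity b ≠ 0 := ((rootMultiplicity_pos hr0).2 hrb).ne'
  generalize r.rootMultiplicity b = n at hs hn
  obtain ⟨m, rfl⟩ := Nat.exists_eq_succ_of_ne_zero hm
  obtain ⟨n, rfl⟩ := Nat.exists_eq_succ_of_ne_zero hn
  rw [dvd_iff_isRoot] at hsb hra
  have hsa : s.eval a ≠ 0 := fun h0 => hra (by rw [IsRoot, hs]; simp [h0])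
  have hps : p = (X - C a) ^ (m + 1) * ((X - C b) ^ (n + 1) * s) := by rw [hr, hs]
  have hs_ne : ∀ c, a ≤ c → c ≤ b → s.eval c ≠ 0 := by
    intro c h1 h2 h3
    rcases h1.eq_or_lt with rfl | h1
    · exact hsa h3
    rcases h2.eq_or_lt with rfl | h2
    · exact hsb h3
    exact hne c h1 h2 (by rw [hps]; simp [h3])
  have hpos := mul_pos_of_forall_ne_zero s hab.le hs_ne
  let g : K[X] := ((m : K[X]) + 1) * (X - C b) * s + ((n : K[X]) + 1) * (X - C a) * s
    + (X - C a) * (X - C b) * derivative s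
  have hga : g.eval a = (m + 1) * (a - b) * s.eval a := by simp [g]
  have hgb : g.eval b = (n + 1) * (b - a) * s.eval b := by simp [g]
  have hba : 0 < b - a := sub_pos.2 hab
  have hm' : (0 : K) < m + 1 := by positivity
  have hn' : (0 : K) < n + 1 := by positivity
  have hg : g.eval a * g.eval b < 0 := by
    rw [hga, hgb]
    have : 0 < ((m + 1) * (b - a)) * ((n + 1) * (b - a)) * (s.eval a * s.eval b) := by positivity
    linarith
  obtain ⟨c, h1, h2, h3⟩ := exists_root_of_mul_nonpos g hab.le hg.le
  refine ⟨c, lt_of_le_of_ne h1 ?_, lt_of_le_of_ne h2 ?_, ?_⟩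
  · rintro rfl; simp [h3] at hg
  · rintro rfl; simp [h3] at hg
  · have : derivative p = (X - C a) ^ m * (X - C b) ^ n * g := by
      rw [hps]
      simp only [derivative_mul, derivative_pow, derivative_sub, derivative_X, derivative_C, g]
      simp only [Nat.cast_add, Nat.cast_one, Nat.add_sub_cancel, map_add, map_one, map_natCast]
      ring
    rw [this, eval_mul, h3, mul_zero]

theorem exists_derivative_eq_zero {p : K[X]} {a b : K} (hab : a < b)
    (h : p.eval a = p.eval b) : ∃ c, a < c ∧ c < b ∧ (derivative p).eval c = 0 := by
  classical
  wlog h0 : p.eval a = 0 generalizing p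
  · obtain ⟨c, hc⟩ := this (p := p - C (p.eval a)) (by simp [h]) (by simp)
    exact ⟨c, by simpa using hc⟩
  by_cases hp : p = 0
  · obtain ⟨c, hc⟩ := exists_between hab
    exact ⟨c, hc.1, hc.2, by simp [hp]⟩
  let R := p.roots.toFinset.filter (fun c => a < c ∧ c ≤ b)
  have hbR : b ∈ R := by simp [R, hp, hab, ← h, h0]
  -- The first root after `a`: Rolle between consecutive roots then applies.
  let b' := R.min' ⟨b, hbR⟩
  have hb' : b' ∈ R := R.min'_mem _
  have hb'2 : p.eval b' = 0 ∧ a < b' ∧ b' ≤ b := by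
    simpa [R, hp] using hb'
  obtain ⟨c, h1, h2, h3⟩ := exists_derivative_eq_zero_of_consecutive hb'2.2.1 hp h0 hb'2.1
    (fun c h1 h2 h3 => not_lt.2 (R.min'_le c (by
      simp [R, hp, h1, h3, h2.le.trans hb'2.2.2])) h2)
  exact ⟨c, h1, h2.trans_le hb'2.2.2, h3⟩

theorem exists_derivative_mul_eq_sub (p : K[X]) {a b : K} (hab : a < b) :
    ∃ c, a < c ∧ c < b ∧ (derivative p).eval c * (b - a) = p.eval b - p.eval a := by
  obtain ⟨c, h1, h2, h3⟩ := exists_derivative_eq_zero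
    (p := p * C (b - a) - C (p.eval b - p.eval a) * X) hab (by simp; ring)
  refine ⟨c, h1, h2, ?_⟩
  simpa [sub_eq_zero] using h3

-- Horner induction on `p = X · divX + p(0)`: a positive lower bound `δ` for `divX` at large `x`
-- makes `X · divX` outgrow the constant term.
omit [HasPolyIVT K] in
theorem exists_lower_bound_of_leadingCoeff_pos (d : ℕ) : ∀ p : K[X], p.natDegree = d →
    0 < p.leadingCoeff → ∃ δ > 0, ∃ M, ∀ x, M ≤ x → δ ≤ p.eval x := by
  induction d with
  | zero =>
    intro p hd hp
    refine ⟨p.leadingCoeff, hp, 0, fun x _ => ?_⟩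
    rw [eq_C_of_natDegree_eq_zero hd]
    simp
  | succ d ih =>
    intro p hd hp
    have hd' : p.divX.natDegree = d := by rw [natDegree_divX_eq_natDegree_tsub_one, hd]; simp
    obtain ⟨δ, hδ, M, hM⟩ := ih p.divX hd' (by
      rwa [leadingCoeff, hd', coeff_divX, ← hd])
    refine ⟨1, one_pos, max (max M 0) ((|p.coeff 0| + 1) / δ), fun x hx => ?_⟩
    have h1 : M ≤ x := (le_max_left _ _).trans ((le_max_left _ _).trans hx)
    have h2 : 0 ≤ x := (le_max_right _ _).trans ((le_max_left _ _).trans hx)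
    have h3 : (|p.coeff 0| + 1) / δ ≤ x := (le_max_right _ _).trans hx
    rw [div_le_iff₀ hδ] at h3
    rw [← divX_mul_X_add p]
    simp only [eval_add, eval_mul, eval_X, eval_C]
    have h4 := mul_le_mul_of_nonneg_right (hM x h1) h2
    have h5 := neg_abs_le (p.coeff 0)
    nlinarith

omit [HasPolyIVT K] in
theorem exists_forall_ge_eval_mul_leadingCoeff_pos {p : K[X]} (hp : p ≠ 0) :
    ∃ M, ∀ x, M ≤ x → 0 < p.eval x * p.leadingCoeff := by
  have hl := leadingCoeff_ne_zero.2 hp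
  obtain ⟨δ, hδ, M, hM⟩ := exists_lower_bound_of_leadingCoeff_pos _ (p * C p.leadingCoeff) rfl
    (by rw [leadingCoeff_mul, leadingCoeff_C]; exact mul_self_pos.2 hl)
  exact ⟨M, fun x hx => hδ.trans_le (by simpa using hM x hx)⟩

end PolyIVT


/-! ### Signs, relative positions and finite diagrams between two ordered fields -/

/-- The elements `a` and `b` of two ordered fields have the same sign. -/
def SameSign {K L : Type*} [Zero K] [LT K] [Zero L] [LT L] (a : K) (b : L) : Prop :=
  (0 < a ↔ 0 < b) ∧ (a < 0 ↔ b < 0)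

/-- The points `ξ` and `x` lie in the same position with respect to the pairs in `S`. -/
def SamePos {K L : Type*} [LT K] [LT L] (S : Finset (K × L)) (ξ : K) (x : L) : Prop :=
  ∀ z ∈ S, (ξ < z.1 ↔ x < z.2) ∧ (z.1 < ξ ↔ z.2 < x)

/-- The pairs in `S` form the graph of an order isomorphism between finite sets. -/
def IsDiagram {K L : Type*} [LT K] [LT L] (S : Finset (K × L)) : Prop :=
  ∀ z ∈ S, SamePos S z.1 z.2

section SameSign

variable {K L : Type*} [Field K] [LinearOrder K] [IsStrictOrderedRing K]
  [Field L] [LinearOrder L] [IsStrictOrderedRing L]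

omit [IsStrictOrderedRing K] [IsStrictOrderedRing L] in
theorem SameSign.symm {a : K} {b : L} (h : SameSign a b) : SameSign b a :=
  ⟨h.1.symm, h.2.symm⟩

omit [IsStrictOrderedRing K] [IsStrictOrderedRing L] in
theorem SameSign.trans {M : Type*} [Zero M] [LT M] {a : K} {b : L} {c : M} (h : SameSign a b)
    (h' : SameSign b c) : SameSign a c :=
  ⟨h.1.trans h'.1, h.2.trans h'.2⟩

omit [IsStrictOrderedRing K] [IsStrictOrderedRing L] in
theorem SameSign.eq_zero_iff {a : K} {b : L} (h : SameSign a b) : a = 0 ↔ b = 0 := by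
  have h1 := h.1
  have h2 := h.2
  constructor <;> rintro rfl <;> apply le_antisymm <;> simp_all

omit [IsStrictOrderedRing K] [IsStrictOrderedRing L] in
theorem sameSign_zero : SameSign (0 : K) (0 : L) := by simp [SameSign]

theorem sameSign_of_mul_pos {a b : K} (h : 0 < a * b) : SameSign a b := by
  rcases mul_pos_iff.1 h with h | h
  · exact ⟨by simp [h.1, h.2], by simp [h.1.not_gt, h.2.not_gt]⟩
  · exact ⟨by simp [h.1.not_gt, h.2.not_gt], by simp [h.1, h.2]⟩

theorem SameSign.mul {a b : K} {c d : L} (h : SameSign a c) (h' : SameSign b d) :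
    SameSign (a * b) (c * d) := by
  constructor
  · rw [mul_pos_iff, mul_pos_iff, h.1, h.2, h'.1, h'.2]
  · rw [mul_neg_iff, mul_neg_iff, h.1, h.2, h'.1, h'.2]

omit [IsStrictOrderedRing K] [IsStrictOrderedRing L] in
theorem sameSign_of_pos {a : K} {c : L} (h : 0 < a) (h' : 0 < c) : SameSign a c := by
  simp [SameSign, h, h', h.not_gt, h'.not_gt]

end SameSign

section Diagram

variable {K L : Type*} [LinearOrder K] [LinearOrder L]

theorem SamePos.mono {S T : Finset (K × L)} (h : S ⊆ T) {ξ : K} {x : L} (hT : SamePos T ξ x) :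
    SamePos S ξ x := fun z hz => hT z (h hz)

theorem IsDiagram.mono {S T : Finset (K × L)} (h : S ⊆ T) (hT : IsDiagram T) : IsDiagram S :=
  fun z hz => (hT z (h hz)).mono h

theorem samePos_swap {S : Finset (K × L)} {ξ : K} {x : L} :
    SamePos (S.map (Equiv.prodComm K L).toEmbedding) x ξ ↔ SamePos S ξ x := by
  simp only [SamePos, Finset.mem_map, Equiv.coe_toEmbedding, Prod.exists, Equiv.prodComm_apply,
    Prod.forall, Prod.swap_prod_mk, Prod.mk.injEq]
  constructor
  · intro h a b hab
    have := h b a ⟨a, b, hab, rfl, rfl⟩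
    exact ⟨this.1.symm, this.2.symm⟩
  · rintro h b a ⟨a', b', hab, rfl, rfl⟩
    have := h _ _ hab
    exact ⟨this.1.symm, this.2.symm⟩

theorem IsDiagram.swap {S : Finset (K × L)} (h : IsDiagram S) :
    IsDiagram (S.map (Equiv.prodComm K L).toEmbedding) := by
  intro z hz
  rw [samePos_swap]
  obtain ⟨w, hw, rfl⟩ := Finset.mem_map.1 hz
  exact h w hw

theorem IsDiagram.insert [DecidableEq (K × L)] {S : Finset (K × L)} (h : IsDiagram S)
    {ξ : K} {x : L} (hx : SamePos S ξ x) : IsDiagram (insert (ξ, x) S) := by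
  intro z hz w hw
  rw [Finset.mem_insert] at hz hw
  rcases hz with rfl | hz <;> rcases hw with rfl | hw
  · simp
  · exact hx w hw
  · exact ⟨(hx z hz).2, (hx z hz).1⟩
  · exact h z hz w hw

theorem SamePos.eq {S : Finset (K × L)} {ξ : K} {x : L} (h : SamePos S ξ x) {z : K × L}
    (hz : z ∈ S) (hξ : ξ = z.1) : x = z.2 := by
  have := h z hz
  subst hξ
  simp only [lt_self_iff_false, false_iff, not_lt] at this
  exact le_antisymm this.2 this.1

theorem SamePos.eq' {S : Finset (K × L)} {ξ : K} {x : L} (h : SamePos S ξ x) {z : K × L}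
    (hz : z ∈ S) (hx : x = z.2) : ξ = z.1 := by
  have := h z hz
  subst hx
  simp only [lt_self_iff_false, iff_false, not_lt] at this
  exact le_antisymm this.2 this.1

/-- The one-point extension step of back-and-forth: a finite cut is filled in a dense order without
endpoints. -/
theorem IsDiagram.exists_samePos [DenselyOrdered L] [NoMinOrder L] [NoMaxOrder L] [Nonempty L]
    {S : Finset (K × L)} (h : IsDiagram S) (ξ : K) : ∃ x, SamePos S ξ x := by
  by_cases hξ : ∃ z ∈ S, z.1 = ξ
  · obtain ⟨z, hz, rfl⟩ := hξ
    exact ⟨z.2, h z hz⟩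
  push Not at hξ
  obtain ⟨x, h1, h2⟩ := Order.exists_between_finsets
    ((S.filter fun z => z.1 < ξ).image Prod.snd) ((S.filter fun z => ξ < z.1).image Prod.snd) (by
      intro x hx y hy
      simp only [Finset.mem_image, Finset.mem_filter] at hx hy
      obtain ⟨z, ⟨hz, hz'⟩, rfl⟩ := hx
      obtain ⟨w, ⟨hw, hw'⟩, rfl⟩ := hy
      exact (h z hz w hw).1.1 (hz'.trans hw'))
  refine ⟨x, fun z hz => ?_⟩
  rcases (hξ z hz).lt_or_gt with hlt | hlt
  · have := h1 z.2 (Finset.mem_image_of_mem _ (Finset.mem_filter.2 ⟨hz, hlt⟩))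
    exact ⟨by simp [hlt.not_gt, this.not_gt], by simp [hlt, this]⟩
  · have := h2 z.2 (Finset.mem_image_of_mem _ (Finset.mem_filter.2 ⟨hz, hlt⟩))
    exact ⟨by simp [hlt, this], by simp [hlt.not_gt, this.not_gt]⟩

omit [LinearOrder L] in
/-- A point that is neither below nor above all of `S` lies strictly between two
consecutive elements of `S`. -/
theorem exists_consecutive {S : Finset (K × L)} {ξ : K} {a b : K × L} (ha : a ∈ S) (haξ : a.1 < ξ)
    (hb : b ∈ S) (hξb : ξ < b.1) :
    ∃ s ∈ S, ∃ t ∈ S, s.1 < ξ ∧ ξ < t.1 ∧ (∀ z ∈ S, z.1 < ξ → z.1 ≤ s.1) ∧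
      (∀ z ∈ S, ξ < z.1 → t.1 ≤ z.1) := by
  obtain ⟨s, hs, hs'⟩ := (S.filter fun z => z.1 < ξ).exists_max_image Prod.fst
    ⟨a, Finset.mem_filter.2 ⟨ha, haξ⟩⟩
  obtain ⟨t, ht, ht'⟩ := (S.filter fun z => ξ < z.1).exists_min_image Prod.fst
    ⟨b, Finset.mem_filter.2 ⟨hb, hξb⟩⟩
  simp only [Finset.mem_filter] at hs ht hs' ht'
  exact ⟨s, hs.1, t, ht.1, hs.2, ht.2, fun z h1 h2 => hs' z ⟨h1, h2⟩, fun z h1 h2 => ht' z ⟨h1, h2⟩⟩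

/-- If `ξ` is strictly between consecutive `s`, `t` in `S`, then so is any point of the
corresponding interval on the other side, and it lies in the same position. -/
theorem IsDiagram.samePos_of_consecutive {S : Finset (K × L)} (h : IsDiagram S) {ξ : K}
    {s t : K × L} (hs : s ∈ S) (ht : t ∈ S)
    (h1 : ∀ z ∈ S, z.1 < ξ → z.1 ≤ s.1) (h2 : ∀ z ∈ S, ξ < z.1 → t.1 ≤ z.1)
    (h3 : ∀ z ∈ S, z.1 ≠ ξ) {x : L} (hsx : s.2 < x) (hxt : x < t.2) : SamePos S ξ x := by
  intro z hz
  rcases (h3 z hz).lt_or_gt with hlt | hlt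
  · have : z.2 ≤ s.2 := not_lt.1 fun hn => (h1 z hz hlt).not_gt ((h s hs z hz).1.2 hn)
    have := this.trans_lt hsx
    exact ⟨by simp [hlt.not_gt, this.not_gt], by simp [hlt, this]⟩
  · have : t.2 ≤ z.2 := not_lt.1 fun hn => (h2 z hz hlt).not_gt ((h t ht z hz).2.2 hn)
    have := hxt.trans_le this
    exact ⟨by simp [hlt, this], by simp [hlt.not_gt, this.not_gt]⟩

end Diagram

/-! ### Polynomials whose sign is read off from a diagram -/

section Compatible

variable {k K L : Type*} [Field k]
  [Field K] [LinearOrder K] [IsStrictOrderedRing K]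
  [Field L] [LinearOrder L] [IsStrictOrderedRing L]

/-- The sign of `p` at a point of `K` or `L` is determined by the position with respect to `S`. -/
def SignDetermined (φ : k →+* K) (ψ : k →+* L) (S : Finset (K × L)) (p : k[X]) : Prop :=
  ∀ ξ x, SamePos S ξ x → SameSign ((p.map φ).eval ξ) ((p.map ψ).eval x)

variable {φ : k →+* K} {ψ : k →+* L} {S T : Finset (K × L)} {p : k[X]}

omit [IsStrictOrderedRing K] [IsStrictOrderedRing L] in
theorem SignDetermined.mono (h : S ⊆ T) (hS : SignDetermined φ ψ S p) :
    SignDetermined φ ψ T p := fun ξ x hx => hS ξ x (hx.mono h)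

theorem SignDetermined.swap (h : SignDetermined φ ψ S p) :
    SignDetermined ψ φ (S.map (Equiv.prodComm K L).toEmbedding) p :=
  fun x ξ hx => (h ξ x (samePos_swap.1 hx)).symm

/-- On an interval of `K` without points of `S` the sign is constant and non-zero. -/
theorem SignDetermined.eval_mul_pos (hS : IsDiagram S) (h : SignDetermined φ ψ S p) (hp : p ≠ 0)
    {u v : K} (huv : u < v) (hno : ∀ z ∈ S, z.1 ≤ u ∨ v ≤ z.1) {c d : K} (huc : u < c)
    (hcv : c < v) (hud : u < d) (hdv : d < v) :
    0 < (p.map φ).eval c * (p.map φ).eval d := by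
  obtain ⟨x, hx⟩ := hS.exists_samePos c
  have key : ∀ e, u < e → e < v → SameSign ((p.map φ).eval e) ((p.map ψ).eval x) := by
    intro e h1 h2
    refine h e x fun z hz => ?_
    rw [← (hx z hz).1, ← (hx z hz).2]
    rcases hno z hz with h | h
    · exact ⟨by simp [(h.trans_lt h1).not_gt, (h.trans_lt huc).not_gt],
        by simp [h.trans_lt h1, h.trans_lt huc]⟩
    · exact ⟨by simp [h2.trans_le h, hcv.trans_le h],
        by simp [(h2.trans_le h).not_gt, (hcv.trans_le h).not_gt]⟩
  have h0 : (p.map ψ).eval x ≠ 0 := by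
    intro h0
    refine (Polynomial.map_ne_zero hp : p.map φ ≠ 0) (eq_zero_of_forall_Ioo huv fun e h1 h2 => ?_)
    exact (key e h1 h2).eq_zero_iff.2 h0
  have := ((key c huc hcv).mul (key d hud hdv)).1
  rw [this]
  exact mul_self_pos.2 h0

/-- The sign does not change up to the end of an interval without points of `S`, if the polynomial
does not vanish there. -/
theorem SignDetermined.sameSign_of_gap [HasPolyIVT K] (hS : IsDiagram S)
    (h : SignDetermined φ ψ S p) (hp : p ≠ 0) {u v : K} (huv : u ≠ v)
    (hno : ∀ z ∈ S, ¬ (z.1 = u) ∧ ¬ (u < z.1 ∧ z.1 < v) ∧ ¬ (v < z.1 ∧ z.1 < u))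
    (hv : (p.map φ).eval v ≠ 0) :
    SameSign ((p.map φ).eval u) ((p.map φ).eval v) := by
  obtain ⟨x, hx⟩ := hS.exists_samePos u
  have key : ∀ e, (u ≤ e ∧ e < v ∨ v < e ∧ e ≤ u) →
      SameSign ((p.map φ).eval e) ((p.map ψ).eval x) := by
    intro e he
    refine h e x fun z hz => ?_
    rw [← (hx z hz).1, ← (hx z hz).2]
    have := hno z hz
    grind
  have h0 : (p.map ψ).eval x ≠ 0 := by
    intro h0
    refine (Polynomial.map_ne_zero hp : p.map φ ≠ 0) ?_
    rcases huv.lt_or_gt with hlt | hlt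
    · exact eq_zero_of_forall_Ioo hlt fun e h1 h2 =>
        (key e (Or.inl ⟨h1.le, h2⟩)).eq_zero_iff.2 h0
    · exact eq_zero_of_forall_Ioo hlt fun e h1 h2 =>
        (key e (Or.inr ⟨h1, h2.le⟩)).eq_zero_iff.2 h0
  have hne : ∀ e, (u ≤ e ∧ e ≤ v ∨ v ≤ e ∧ e ≤ u) → (p.map φ).eval e ≠ 0 := by
    intro e he
    by_cases hev : e = v
    · rwa [hev]
    · rw [Ne, (key e (by grind)).eq_zero_iff]
      exact h0
  rcases huv.lt_or_gt with hlt | hlt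
  · exact sameSign_of_mul_pos (mul_pos_of_forall_ne_zero _ hlt.le fun e h1 h2 =>
      hne e (Or.inl ⟨h1, h2⟩))
  · exact sameSign_of_mul_pos (by
      rw [mul_comm]
      exact mul_pos_of_forall_ne_zero _ hlt.le fun e h1 h2 => hne e (Or.inr ⟨h1, h2⟩))

/-- A point of `S` at which `p` does not vanish is superfluous. -/
theorem SignDetermined.of_insert [HasPolyIVT K] [HasPolyIVT L] [DecidableEq (K × L)] {z : K × L}
    (hS : IsDiagram (insert z S)) (hzS : z ∉ S) (h : SignDetermined φ ψ (insert z S) p)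
    (hz : p ≠ 0 → (p.map φ).eval z.1 ≠ 0) : SignDetermined φ ψ S p := by
  intro ξ x hx
  by_cases hp : p = 0
  · simpa [hp] using sameSign_zero
  have hz := hz hp
  have hzz : SameSign ((p.map φ).eval z.1) ((p.map ψ).eval z.2) :=
    h _ _ (hS z (Finset.mem_insert_self _ _))
  have hzp := hS z (Finset.mem_insert_self _ _)
  -- If `ξ` and `x` lie differently relative to `z`, no other point of the diagram separates either
  -- of them from `z`. Both signs then agree with the sign of `p` at `z`.
  by_cases hpos : (ξ < z.1 ↔ x < z.2) ∧ (z.1 < ξ ↔ z.2 < x)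
  · refine h ξ x fun w hw => ?_
    rcases Finset.mem_insert.1 hw with rfl | hw
    · exact hpos
    · exact hx w hw
  have hzero : (p.map ψ).eval z.2 ≠ 0 := by rwa [Ne, ← hzz.eq_zero_iff]
  have hK : ∀ w ∈ insert z S, ξ ≠ z.1 →
      ¬ (w.1 = ξ) ∧ ¬ (ξ < w.1 ∧ w.1 < z.1) ∧ ¬ (z.1 < w.1 ∧ w.1 < ξ) := by
    intro w hw hne
    rcases Finset.mem_insert.1 hw with rfl | hw'
    · exact ⟨hne.symm, by simp, by simp⟩
    · have h1 := hx w hw'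
      have h2 := hzp w hw
      grind
  have hL : ∀ w ∈ insert z S, x ≠ z.2 →
      ¬ (w.2 = x) ∧ ¬ (x < w.2 ∧ w.2 < z.2) ∧ ¬ (z.2 < w.2 ∧ w.2 < x) := by
    intro w hw hne
    rcases Finset.mem_insert.1 hw with rfl | hw'
    · exact ⟨hne.symm, by simp, by simp⟩
    · have h1 := hx w hw'
      have h2 := hzp w hw
      grind
  have h1 : SameSign ((p.map φ).eval ξ) ((p.map φ).eval z.1) := by
    by_cases hne : ξ = z.1
    · rw [hne]; exact ⟨Iff.rfl, Iff.rfl⟩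
    · exact h.sameSign_of_gap hS hp hne (fun w hw => hK w hw hne) hz
  have h2 : SameSign ((p.map ψ).eval x) ((p.map ψ).eval z.2) := by
    by_cases hne : x = z.2
    · rw [hne]; exact ⟨Iff.rfl, Iff.rfl⟩
    · refine h.swap.sameSign_of_gap hS.swap hp hne (fun w hw => ?_) hzero
      obtain ⟨w', hw', rfl⟩ := Finset.mem_map.1 hw
      exact hL w' hw' hne
  exact (h1.trans hzz).trans h2.symm

/-- Thinning: superfluous points are discarded one at a time. At a point that survives some `r ∈ Γ`
vanishes, so any `p` takes the value of `p % r` there. -/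
theorem exists_subset_roots [HasPolyIVT K] [HasPolyIVT L] (Γ : Finset k[X]) (hS : IsDiagram S)
    (h : ∀ p ∈ Γ, SignDetermined φ ψ S p) :
    ∃ T ⊆ S, (∀ p ∈ Γ, SignDetermined φ ψ T p) ∧
      ∀ z ∈ T, ∃ p ∈ Γ, p ≠ 0 ∧ (p.map φ).eval z.1 = 0 := by
  classical
  induction hn : S.card generalizing S with
  | zero =>
    obtain rfl := Finset.card_eq_zero.1 hn
    exact ⟨∅, subset_rfl, h, by simp⟩
  | succ n ih =>
    by_cases hall : ∀ z ∈ S, ∃ p ∈ Γ, p ≠ 0 ∧ (p.map φ).eval z.1 = 0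
    · exact ⟨S, subset_rfl, h, hall⟩
    · push Not at hall
      obtain ⟨z, hz, hall⟩ := hall
      rw [← Finset.insert_erase hz] at hS h
      obtain ⟨T, hT, hT'⟩ := ih (S := S.erase z) (hS.mono (Finset.subset_insert _ _))
        (fun p hp => (h p hp).of_insert hS (Finset.notMem_erase _ _) (hall p hp))
        (by rw [Finset.card_erase_of_mem hz, hn]; rfl)
      exact ⟨T, hT.trans (Finset.erase_subset _ _), hT'⟩

end Compatible


/-! ### Sign-table induction: transfer of sign conditions in one variable -/

section Elimination

variable {k K L : Type*} [Field k]
  [Field K] [LinearOrder K] [IsStrictOrderedRing K]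
  [Field L] [LinearOrder L] [IsStrictOrderedRing L]
  {φ : k →+* K} {ψ : k →+* L} {S T : Finset (K × L)} {p : k[X]}

/-- The diagram `S` determines the sign of `p'`, matches the signs of `p` at its own points, and
bounds all the roots of `p`. -/
structure IsRootFrame (φ : k →+* K) (ψ : k →+* L) (S : Finset (K × L)) (p : k[X]) : Prop where
  isDiagram : IsDiagram S
  derivative : SignDetermined φ ψ S (derivative p)
  sameSign : ∀ z ∈ S, SameSign ((p.map φ).eval z.1) ((p.map ψ).eval z.2)
  bound_left : ∀ ξ, (p.map φ).eval ξ = 0 → ∃ a ∈ S, ∃ b ∈ S, a.1 < ξ ∧ ξ < b.1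
  bound_right : ∀ x, (p.map ψ).eval x = 0 → ∃ a ∈ S, ∃ b ∈ S, a.2 < x ∧ x < b.2

theorem IsRootFrame.swap (h : IsRootFrame φ ψ S p) :
    IsRootFrame ψ φ (S.map (Equiv.prodComm K L).toEmbedding) p where
  isDiagram := h.isDiagram.swap
  derivative := h.derivative.swap
  sameSign z hz := by
    obtain ⟨w, hw, rfl⟩ := Finset.mem_map.1 hz
    exact (h.sameSign w hw).symm
  bound_left x hx := by
    obtain ⟨a, ha, b, hb, hab⟩ := h.bound_right x hx
    exact ⟨_, Finset.mem_map_of_mem _ ha, _, Finset.mem_map_of_mem _ hb, hab⟩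
  bound_right x hx := by
    obtain ⟨a, ha, b, hb, hab⟩ := h.bound_left x hx
    exact ⟨_, Finset.mem_map_of_mem _ ha, _, Finset.mem_map_of_mem _ hb, hab⟩

variable [HasPolyIVT K] [HasPolyIVT L]

/-- In the gap of `S` around `ρ` the derivative has constant non-zero sign, so by the mean value
theorem `p` has opposite signs at the two ends. These signs are the same in `L`, where the
intermediate value property gives the root. -/
theorem IsRootFrame.exists_root (h : IsRootFrame φ ψ S p) (hp : Polynomial.derivative p ≠ 0) {ρ : K}
    (hρ : (p.map φ).eval ρ = 0) (hρS : ∀ z ∈ S, z.1 ≠ ρ) :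
    ∃ ρ', (p.map ψ).eval ρ' = 0 ∧ SamePos S ρ ρ' := by
  obtain ⟨a, ha, b, hb, haρ, hρb⟩ := h.bound_left ρ hρ
  obtain ⟨s, hs, t, ht, hsρ, hρt, h1, h2⟩ := exists_consecutive ha haρ hb hρb
  obtain ⟨c, hc1, hc2, hc⟩ := exists_derivative_mul_eq_sub (p.map φ) hsρ
  obtain ⟨d, hd1, hd2, hd⟩ := exists_derivative_mul_eq_sub (p.map φ) hρt
  rw [derivative_map] at hc hd
  have hpos := h.derivative.eval_mul_pos h.isDiagram hp (hsρ.trans hρt) (fun z hz => by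
    rcases (hρS z hz).lt_or_gt with hlt | hlt
    · exact Or.inl (h1 z hz hlt)
    · exact Or.inr (h2 z hz hlt)) hc1 (hc2.trans hρt) (hsρ.trans hd1) hd2
  have hneg : (p.map φ).eval s.1 * (p.map φ).eval t.1 < 0 := by
    rw [hρ] at hc hd
    have e1 : (p.map φ).eval s.1 = -((Polynomial.derivative p).map φ).eval c * (ρ - s.1) := by
      linarith
    have e2 : (p.map φ).eval t.1 = ((Polynomial.derivative p).map φ).eval d * (t.1 - ρ) := by
      linarith
    rw [e1, e2]
    have := mul_pos hpos (mul_pos (sub_pos.2 hsρ) (sub_pos.2 hρt))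
    linarith
  rw [((h.sameSign s hs).mul (h.sameSign t ht)).2] at hneg
  have hst := (h.isDiagram s hs t ht).1.1 (hsρ.trans hρt)
  obtain ⟨ρ', hr1, hr2, hr3⟩ := exists_root_of_mul_nonpos _ hst.le hneg.le
  refine ⟨ρ', hr3, h.isDiagram.samePos_of_consecutive hs ht h1 h2 hρS
    (lt_of_le_of_ne hr1 ?_) (lt_of_le_of_ne hr2 ?_)⟩
  · rintro rfl; simp [hr3] at hneg
  · rintro rfl; simp [hr3] at hneg

/-- Once all roots of `p` are in `S`, the sign in a gap is the sign at its left end `s` if `p(s) ≠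
0`, and the sign of `p'` in the gap if `p(s) = 0`. Left of all of `S`, the least point of `S` is
used instead. -/
theorem IsRootFrame.signDetermined (h : IsRootFrame φ ψ S p)
    (hp : Polynomial.derivative p ≠ 0) (hne : S.Nonempty)
    (hroots : ∀ ξ, (p.map φ).eval ξ = 0 → ∃ z ∈ S, z.1 = ξ) : SignDetermined φ ψ S p := by
  -- A root in `L` outside `S` would produce, by the swapped `exists_root`, a root in `K` outside
  -- `S`.
  have hroots' : ∀ x, (p.map ψ).eval x = 0 → ∃ z ∈ S, z.2 = x := by
    intro x hx
    by_contra! hn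
    obtain ⟨ρ, hρ, hpos⟩ := h.swap.exists_root hp hx (fun z hz => by
      obtain ⟨w, hw, rfl⟩ := Finset.mem_map.1 hz
      exact hn w hw)
    rw [samePos_swap] at hpos
    obtain ⟨z, hz, rfl⟩ := hroots ρ hρ
    exact hn z hz (hpos.eq hz rfl).symm
  intro ξ x hx
  by_cases hξ : ∃ z ∈ S, z.1 = ξ
  · obtain ⟨z, hz, rfl⟩ := hξ
    rw [hx.eq hz rfl]
    exact h.sameSign z hz
  push Not at hξ
  have hxS : ∀ z ∈ S, z.2 ≠ x := fun z hz hzx => hξ z hz (hx.eq' hz hzx.symm).symm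
  by_cases hlow : ∃ a ∈ S, a.1 < ξ
  · obtain ⟨a, ha, haξ⟩ := hlow
    obtain ⟨s, hs, hmax⟩ := (S.filter fun z => z.1 < ξ).exists_max_image Prod.fst
      ⟨a, Finset.mem_filter.2 ⟨ha, haξ⟩⟩
    simp only [Finset.mem_filter, and_imp] at hs hmax
    obtain ⟨hs, hsξ⟩ := hs
    have hsx := (hx s hs).2.1 hsξ
    have hgap : ∀ c, s.1 < c → c ≤ ξ → ∀ z ∈ S, (c < z.1 ↔ ξ < z.1) ∧ (z.1 < c ↔ z.1 < ξ) := by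
      intro c h1 h2 z hz
      have := hmax z hz
      have := hξ z hz
      grind
    have hgap' : ∀ c, s.2 < c → c ≤ x → ∀ z ∈ S, (c < z.2 ↔ x < z.2) ∧ (z.2 < c ↔ z.2 < x) := by
      intro c h1 h2 z hz
      have := hmax z hz
      have := hξ z hz
      have := hxS z hz
      have := hx z hz
      have := h.isDiagram s hs z hz
      grind
    have hnr : ∀ c, s.1 < c → c ≤ ξ → (p.map φ).eval c ≠ 0 := by
      intro c h1 h2 h3
      obtain ⟨z, hz, rfl⟩ := hroots c h3
      have := hmax z hz
      have := hξ z hz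
      grind
    have hnr' : ∀ c, s.2 < c → c ≤ x → (p.map ψ).eval c ≠ 0 := by
      intro c h1 h2 h3
      obtain ⟨z, hz, rfl⟩ := hroots' c h3
      have := hgap' _ h1 h2 z hz
      have := hxS z hz
      grind
    by_cases h0 : (p.map φ).eval s.1 = 0
    · have h0' := (h.sameSign s hs).eq_zero_iff.1 h0
      obtain ⟨c, hc1, hc2, hc⟩ := exists_derivative_mul_eq_sub (p.map φ) hsξ
      obtain ⟨d, hd1, hd2, hd⟩ := exists_derivative_mul_eq_sub (p.map ψ) hsx
      rw [derivative_map, h0, sub_zero] at hc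
      rw [derivative_map, h0', sub_zero] at hd
      rw [← hc, ← hd]
      refine (h.derivative c d fun z hz => ?_).mul (sameSign_of_pos (by simpa) (by simpa))
      rw [(hgap c hc1 hc2.le z hz).1, (hgap c hc1 hc2.le z hz).2, (hgap' d hd1 hd2.le z hz).1,
        (hgap' d hd1 hd2.le z hz).2]
      exact hx z hz
    · have h0' : (p.map ψ).eval s.2 ≠ 0 := by rwa [Ne, ← (h.sameSign s hs).eq_zero_iff]
      have e1 := mul_pos_of_forall_ne_zero (p.map φ) hsξ.le (fun c h1 h2 => by
        rcases h1.eq_or_lt with rfl | h1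
        · exact h0
        · exact hnr c h1 h2)
      have e2 := mul_pos_of_forall_ne_zero (p.map ψ) hsx.le (fun c h1 h2 => by
        rcases h1.eq_or_lt with rfl | h1
        · exact h0'
        · exact hnr' c h1 h2)
      exact ((sameSign_of_mul_pos e1).symm.trans (h.sameSign s hs)).trans (sameSign_of_mul_pos e2)
  · push Not at hlow
    obtain ⟨t, ht, hmin⟩ := S.exists_min_image Prod.fst hne
    have hmin' : ∀ z ∈ S, t.2 ≤ z.2 := fun z hz =>
      not_lt.1 fun hn => (hmin z hz).not_gt ((h.isDiagram z hz t ht).1.2 hn)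
    have hξt : ξ < t.1 := lt_of_le_of_ne (hlow t ht) (hξ t ht).symm
    have hxt := (hx t ht).1.1 hξt
    have hnr : ∀ c, c ≤ t.1 → (p.map φ).eval c ≠ 0 := by
      intro c h1 h2
      obtain ⟨a, ha, -, -, hac, -⟩ := h.bound_left c h2
      exact (hac.trans_le h1).not_ge (hmin a ha)
    have hnr' : ∀ c, c ≤ t.2 → (p.map ψ).eval c ≠ 0 := by
      intro c h1 h2
      obtain ⟨a, ha, -, -, hac, -⟩ := h.bound_right c h2
      exact (hac.trans_le h1).not_ge (hmin' a ha)
    have e1 := mul_pos_of_forall_ne_zero (p.map φ) hξt.le (fun c _ h2 => hnr c h2)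
    have e2 := mul_pos_of_forall_ne_zero (p.map ψ) hxt.le (fun c _ h2 => hnr' c h2)
    exact ((sameSign_of_mul_pos e1).trans (h.sameSign t ht)).trans (sameSign_of_mul_pos e2).symm

omit [HasPolyIVT K] [HasPolyIVT L] in
theorem IsRootFrame.insert [DecidableEq (K × L)] (h : IsRootFrame φ ψ S p) {ξ : K} {x : L}
    (hpos : SamePos S ξ x) (hs : SameSign ((p.map φ).eval ξ) ((p.map ψ).eval x)) :
    IsRootFrame φ ψ (insert (ξ, x) S) p where
  isDiagram := h.isDiagram.insert hpos
  derivative := h.derivative.mono (Finset.subset_insert _ _)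
  sameSign z hz := by
    rcases Finset.mem_insert.1 hz with rfl | hz
    · exact hs
    · exact h.sameSign z hz
  bound_left ξ hξ := by
    obtain ⟨a, ha, b, hb, hab⟩ := h.bound_left ξ hξ
    exact ⟨a, Finset.mem_insert_of_mem ha, b, Finset.mem_insert_of_mem hb, hab⟩
  bound_right ξ hξ := by
    obtain ⟨a, ha, b, hb, hab⟩ := h.bound_right ξ hξ
    exact ⟨a, Finset.mem_insert_of_mem ha, b, Finset.mem_insert_of_mem hb, hab⟩

/-- The missing roots of `p` in `K` are adjoined one at a time, each with its partner in `L`. -/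
theorem IsRootFrame.exists_signDetermined (h : IsRootFrame φ ψ S p)
    (hp : Polynomial.derivative p ≠ 0) (hne : S.Nonempty) :
    ∃ T, S ⊆ T ∧ IsDiagram T ∧ SignDetermined φ ψ T p := by
  classical
  have hp0 : p.map φ ≠ 0 := Polynomial.map_ne_zero (by rintro rfl; simp at hp)
  induction hn : ((p.map φ).roots.toFinset \ S.image Prod.fst).card generalizing S with
  | zero =>
    refine ⟨S, subset_rfl, h.isDiagram, h.signDetermined hp hne fun ξ hξ => ?_⟩
    rw [Finset.card_eq_zero, Finset.sdiff_eq_empty_iff_subset] at hn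
    have := hn (show ξ ∈ (p.map φ).roots.toFinset by simpa [hp0])
    simpa using this
  | succ n ih =>
    obtain ⟨ρ, hρ⟩ : ((p.map φ).roots.toFinset \ S.image Prod.fst).Nonempty := by
      rw [← Finset.card_pos, hn]; simp
    have hρ' := hρ
    rw [Finset.mem_sdiff, Multiset.mem_toFinset, mem_roots hp0] at hρ
    obtain ⟨ρ', h1, h2⟩ := h.exists_root hp hρ.1 (fun z hz hzρ =>
      hρ.2 (Finset.mem_image.2 ⟨z, hz, hzρ⟩))
    have hfr := h.insert h2 (by rw [h1, hρ.1]; exact sameSign_zero)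
    obtain ⟨T, hT, hT'⟩ := ih hfr (Finset.insert_nonempty _ _) (by
      rw [Finset.image_insert, Finset.sdiff_insert, Finset.card_erase_of_mem hρ', hn]; simp)
    exact ⟨T, (Finset.subset_insert _ _).trans hT, hT'⟩

omit [HasPolyIVT K] in
theorem exists_forall_ge_eval_map_mul_pos (φ : k →+* K) (B : K) {p : k[X]} (hp : p ≠ 0) :
    ∃ M, B < M ∧ ∀ x, M ≤ x → 0 < (p.map φ).eval x * φ p.leadingCoeff := by
  obtain ⟨M, hM⟩ := exists_forall_ge_eval_mul_leadingCoeff_pos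
    (Polynomial.map_ne_zero hp : p.map φ ≠ 0)
  refine ⟨max M (B + 1), lt_max_of_lt_right (lt_add_one B), fun x hx => ?_⟩
  have := hM x ((le_max_left _ _).trans hx)
  rwa [leadingCoeff_map] at this

omit [HasPolyIVT K] in
theorem exists_forall_le_eval_map_mul_pos (φ : k →+* K) (B : K) {p : k[X]} (hp : p ≠ 0) :
    ∃ M, M < B ∧ ∀ x, x ≤ M → 0 < (p.map φ).eval x * φ (p.comp (-X)).leadingCoeff := by
  have hq : p.comp (-X) ≠ 0 := by
    intro h
    apply hp
    have := congrArg (fun r => r.comp (-X)) h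
    simpa [comp_assoc] using this
  obtain ⟨M, hM, hM'⟩ := exists_forall_ge_eval_map_mul_pos φ (-B) hq
  refine ⟨-M, neg_lt.1 hM, fun x hx => ?_⟩
  have := hM' (-x) (le_neg.1 hx)
  simpa [map_comp] using this

-- Two endpoints are added beyond all roots and all of `S`. The signs there are those of the leading
-- coefficients of `p` and `p(-X)`, which `φ` and `ψ` respect.
omit [HasPolyIVT K] [HasPolyIVT L] in
theorem exists_isRootFrame (hφψ : ∀ a, SameSign (φ a) (ψ a)) (hp : p ≠ 0) (hS : IsDiagram S)
    (hd : SignDetermined φ ψ S (Polynomial.derivative p))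
    (hs : ∀ z ∈ S, SameSign ((p.map φ).eval z.1) ((p.map ψ).eval z.2)) :
    ∃ T, S ⊆ T ∧ T.Nonempty ∧ IsRootFrame φ ψ T p := by
  classical
  obtain ⟨B, hB⟩ := (S.image Prod.fst).bddAbove
  obtain ⟨B', hB'⟩ := (S.image Prod.snd).bddAbove
  obtain ⟨b, hb⟩ := (S.image Prod.fst).bddBelow
  obtain ⟨b', hb'⟩ := (S.image Prod.snd).bddBelow
  obtain ⟨M, h1, h1'⟩ := exists_forall_ge_eval_map_mul_pos φ B hp
  obtain ⟨N, h2, h2'⟩ := exists_forall_ge_eval_map_mul_pos ψ B' hp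
  obtain ⟨m, h3, h3'⟩ := exists_forall_le_eval_map_mul_pos φ (min b M) hp
  obtain ⟨n, h4, h4'⟩ := exists_forall_le_eval_map_mul_pos ψ (min b' N) hp
  have hmM := h3.trans_le (min_le_right _ _)
  have hnN := h4.trans_le (min_le_right _ _)
  replace h3 := h3.trans_le (min_le_left _ _)
  replace h4 := h4.trans_le (min_le_left _ _)
  have hz : ∀ z ∈ S, (m < z.1 ∧ z.1 < M) ∧ (n < z.2 ∧ z.2 < N) := fun z hz =>
    ⟨⟨h3.trans_le (hb (Finset.mem_coe.2 (Finset.mem_image_of_mem _ hz))),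
      (hB (Finset.mem_coe.2 (Finset.mem_image_of_mem _ hz))).trans_lt h1⟩,
      ⟨h4.trans_le (hb' (Finset.mem_coe.2 (Finset.mem_image_of_mem _ hz))),
      (hB' (Finset.mem_coe.2 (Finset.mem_image_of_mem _ hz))).trans_lt h2⟩⟩
  have hM : SamePos S M N := fun z hzS => by grind
  have hm : SamePos (insert (M, N) S) m n := fun z hzS => by
    rcases Finset.mem_insert.1 hzS with rfl | hzS <;> grind
  have hT : IsDiagram (insert (m, n) (insert (M, N) S)) := (hS.insert hM).insert hm
  have hsub : S ⊆ insert (m, n) (insert (M, N) S) :=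
    (Finset.subset_insert _ _).trans (Finset.subset_insert _ _)
  refine ⟨_, hsub, Finset.insert_nonempty _ _, hT, hd.mono hsub, ?_, ?_, ?_⟩
  · intro z hz
    rcases Finset.mem_insert.1 hz with rfl | hz
    · exact ((sameSign_of_mul_pos (h3' m le_rfl)).trans (hφψ _)).trans
        (sameSign_of_mul_pos (h4' n le_rfl)).symm
    rcases Finset.mem_insert.1 hz with rfl | hz
    · exact ((sameSign_of_mul_pos (h1' M le_rfl)).trans (hφψ _)).trans
        (sameSign_of_mul_pos (h2' N le_rfl)).symm
    · exact hs z hz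
  · intro ξ hξ
    refine ⟨(m, n), by simp, (M, N), by simp, not_le.1 fun h => ?_, not_le.1 fun h => ?_⟩
    · simpa [hξ] using h3' ξ h
    · simpa [hξ] using h1' ξ h
  · intro ξ hξ
    refine ⟨(m, n), by simp, (M, N), by simp, not_le.1 fun h => ?_, not_le.1 fun h => ?_⟩
    · simpa [hξ] using h4' ξ h
    · simpa [hξ] using h2' ξ h

/-- Signs of finitely many polynomials over a common subfield of two ordered fields with the
intermediate value property are governed by a common finite diagram. -/
theorem exists_diagram_signDetermined (hφψ : ∀ a, SameSign (φ a) (ψ a)) (d : ℕ) :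
    ∀ Γ : Finset k[X], (∀ p ∈ Γ, p.natDegree ≤ d) →
      ∃ S : Finset (K × L), IsDiagram S ∧ ∀ p ∈ Γ, SignDetermined φ ψ S p := by
  classical
  induction d with
  | zero =>
    intro Γ hΓ
    refine ⟨∅, by simp [IsDiagram], fun p hp ξ x _ => ?_⟩
    rw [eq_C_of_natDegree_le_zero (hΓ p hp)]
    simpa using hφψ _
  | succ d ihd =>
    intro Γ hΓ
    induction hn : (Γ.filter fun p => p.natDegree = d + 1).card generalizing Γ with
    | zero =>
      refine ihd Γ fun p hp => ?_
      rw [Finset.card_eq_zero, Finset.filter_eq_empty_iff] at hn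
      have := hn hp
      have := hΓ p hp
      omega
    | succ n ih =>
      obtain ⟨p, hp⟩ : (Γ.filter fun p => p.natDegree = d + 1).Nonempty := by
        rw [← Finset.card_pos, hn]; simp
      obtain ⟨hpΓ, hpd⟩ := Finset.mem_filter.1 hp
      have hp0 : p ≠ 0 := by rintro rfl; simp at hpd
      have hdp : Polynomial.derivative p ≠ 0 := by
        have : CharZero k := RingHom.charZero φ
        intro h
        have := derivative_eq_zero.1 h
        omega
      have hdd : (Polynomial.derivative p).natDegree ≤ d := by
        have := natDegree_derivative_le p
        omega
      -- One polynomial `p` of top degree is traded for `p'` and its remainders modulo the other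
      -- polynomials and `p'`. This removes a polynomial of degree `d + 1` and creates none.
      let Γ₀ := insert (Polynomial.derivative p) (Γ.erase p)
      let Γ₁ := Γ₀ ∪ (Γ₀.filter (· ≠ 0)).image (p % ·)
      have hΓ₀ : ∀ r ∈ Γ₀, r.natDegree ≤ d + 1 := by
        intro r hr
        rcases Finset.mem_insert.1 hr with rfl | hr
        · omega
        · exact hΓ r (Finset.mem_of_mem_erase hr)
      have hrem : ∀ r ∈ Γ₀, r ≠ 0 → (p % r).natDegree ≤ d := by
        intro r hr hr0
        by_cases h0 : r.natDegree = 0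
        · obtain ⟨c, rfl⟩ := natDegree_eq_zero.1 h0
          have : (C c : k[X]) ∣ p := (isUnit_C.2 (isUnit_iff_ne_zero.2 (by simpa using hr0))).dvd
          rw [EuclideanDomain.mod_eq_zero.2 this]
          simp
        · have := natDegree_mod_lt p h0
          have := hΓ₀ r hr
          omega
      obtain ⟨S, hS, hSΓ⟩ := ih Γ₁ (by
        intro r hr
        rcases Finset.mem_union.1 hr with hr | hr
        · exact hΓ₀ r hr
        · obtain ⟨s, hs, rfl⟩ := Finset.mem_image.1 hr
          rw [Finset.mem_filter] at hs
          exact (hrem s hs.1 hs.2).trans (Nat.le_succ d)) (by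
        have : Γ₁.filter (fun p => p.natDegree = d + 1) =
            (Γ.filter fun p => p.natDegree = d + 1).erase p := by
          ext r
          simp only [Γ₁, Finset.mem_filter, Finset.mem_union, Finset.mem_erase, Finset.mem_image]
          constructor
          · rintro ⟨hr | ⟨s, hs, rfl⟩, hrd⟩
            · rcases Finset.mem_insert.1 hr with rfl | hr
              · omega
              · rw [Finset.mem_erase] at hr
                exact ⟨hr.1, hr.2, hrd⟩
            · have := hrem s hs.1 hs.2
              omega
          · rintro ⟨h1, h2, h3⟩
            exact ⟨Or.inl (Finset.mem_insert_of_mem (Finset.mem_erase.2 ⟨h1, h2⟩)), h3⟩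
        rw [this, Finset.card_erase_of_mem hp, hn]
        rfl)
      -- After thinning, `p` equals one of its remainders at every point of `T`, so its signs there
      -- agree in `K` and `L`.
      obtain ⟨T, hTS, hTΓ, hTr⟩ := exists_subset_roots Γ₀ hS fun r hr =>
        hSΓ r (Finset.mem_union_left _ hr)
      have hT := hS.mono hTS
      obtain ⟨T', hTT', hne, hfr⟩ := exists_isRootFrame hφψ hp0 hT
        (hTΓ _ (Finset.mem_insert_self _ _)) (by
        intro z hz
        obtain ⟨r, hr, hr0, hrz⟩ := hTr z hz
        have hrz' := (hTΓ r hr _ _ (hT z hz)).eq_zero_iff.1 hrz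
        have := hSΓ (p % r) (Finset.mem_union_right _ (Finset.mem_image.2
          ⟨r, Finset.mem_filter.2 ⟨hr, hr0⟩, rfl⟩)) _ _ (hS z (hTS hz))
        rw [← EuclideanDomain.mod_add_div p r]
        simpa [hrz, hrz'] using this)
      obtain ⟨T'', h1, h2, h3⟩ := hfr.exists_signDetermined hdp hne
      refine ⟨T'', h2, fun r hr => ?_⟩
      by_cases hrp : r = p
      · rwa [hrp]
      · exact (hTΓ r (Finset.mem_insert_of_mem (Finset.mem_erase.2 ⟨hrp, hr⟩))).mono
          (hTT'.trans h1)

theorem exists_sameSign_of_field (hφψ : ∀ a, SameSign (φ a) (ψ a)) (Γ : Finset k[X]) (ξ : K) :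
    ∃ x : L, ∀ p ∈ Γ, SameSign ((p.map φ).eval ξ) ((p.map ψ).eval x) := by
  obtain ⟨S, hS, h⟩ := exists_diagram_signDetermined hφψ (Γ.sup natDegree) Γ
    (fun p hp => Finset.le_sup hp)
  obtain ⟨x, hx⟩ := hS.exists_samePos ξ
  exact ⟨x, fun p hp => h p hp ξ x hx⟩

end Elimination

/-- Equal signs force equal kernels, so both maps factor through the fraction field of `D` modulo
this prime ideal. Allowing a ring `D` lets the induction on variables replace `D` by `D[X]`. -/
theorem exists_sameSign {D K L : Type*} [CommRing D]
    [Field K] [LinearOrder K] [IsStrictOrderedRing K] [HasPolyIVT K]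
    [Field L] [LinearOrder L] [IsStrictOrderedRing L] [HasPolyIVT L]
    {φ : D →+* K} {ψ : D →+* L} (hφψ : ∀ a, SameSign (φ a) (ψ a)) (Γ : Finset D[X]) (ξ : K) :
    ∃ x : L, ∀ p ∈ Γ, SameSign (p.eval₂ φ ξ) (p.eval₂ ψ x) := by
  classical
  have hker : ∀ a, a ∈ RingHom.ker φ → ψ a = 0 := fun a ha => (hφψ a).eq_zero_iff.1 ha
  have : (RingHom.ker φ).IsPrime := RingHom.ker_isPrime φ
  let φ' : D ⧸ RingHom.ker φ →+* K := Ideal.Quotient.lift _ φ (fun _ h => h)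
  let ψ' : D ⧸ RingHom.ker φ →+* L := Ideal.Quotient.lift _ ψ hker
  have hφψ' : ∀ a, SameSign (φ' a) (ψ' a) := fun a => by
    obtain ⟨a, rfl⟩ := Ideal.Quotient.mk_surjective a
    exact hφψ a
  have hφ' : Function.Injective φ' := RingHom.kerLift_injective φ
  have hψ' : Function.Injective ψ' := (injective_iff_map_eq_zero _).2 fun a ha =>
    hφ' (by rw [(hφψ' a).eq_zero_iff.2 ha, map_zero])
  let F := FractionRing (D ⧸ RingHom.ker φ)
  let Φ : F →+* K := IsFractionRing.lift hφ'
  let Ψ : F →+* L := IsFractionRing.lift hψ'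
  have hΦΨ : ∀ a, SameSign (Φ a) (Ψ a) := fun a => by
    obtain ⟨x, y, hy, rfl⟩ := IsFractionRing.div_surjective (A := D ⧸ RingHom.ker φ) a
    have hy0 : y ≠ 0 := nonZeroDivisors.ne_zero hy
    -- A fraction `x / y` has the sign of `x * y`.
    have e1 : Φ (algebraMap _ F x / algebraMap _ F y) = φ' x * φ' y / (φ' y * φ' y) := by
      rw [mul_div_mul_right _ _ (by simpa using hφ'.ne hy0), map_div₀]
      simp [Φ]
    have e2 : Ψ (algebraMap _ F x / algebraMap _ F y) = ψ' x * ψ' y / (ψ' y * ψ' y) := by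
      rw [mul_div_mul_right _ _ (by simpa using hψ'.ne hy0), map_div₀]
      simp [Ψ]
    rw [e1, e2, div_eq_mul_inv, div_eq_mul_inv]
    refine ((hφψ' x).mul (hφψ' y)).mul (sameSign_of_pos ?_ ?_)
    · exact inv_pos.2 (mul_self_pos.2 (by simpa using hφ'.ne hy0))
    · exact inv_pos.2 (mul_self_pos.2 (by simpa using hψ'.ne hy0))
  let ι : D →+* F := (algebraMap _ F).comp (Ideal.Quotient.mk (RingHom.ker φ))
  have hφι : Φ.comp ι = φ := by
    ext a
    exact (IsFractionRing.lift_algebraMap hφ' _).trans rfl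
  have hψι : Ψ.comp ι = ψ := by
    ext a
    exact (IsFractionRing.lift_algebraMap hψ' _).trans rfl
  obtain ⟨x, hx⟩ := exists_sameSign_of_field hΦΨ (Γ.image (Polynomial.map ι)) ξ
  refine ⟨x, fun p hp => ?_⟩
  have := hx _ (Finset.mem_image_of_mem _ hp)
  rwa [Polynomial.map_map, Polynomial.map_map, hφι, hψι, eval_map, eval_map] at this

end

/-! ### Ultrapowers and transfer of sign conditions in several variables -/

section Ultrapower

variable {ι : Type*} {L : Type*} [Field L] [LinearOrder L] [IsStrictOrderedRing L]
  (U : Ultrafilter ι)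

omit [LinearOrder L] [IsStrictOrderedRing L] in
theorem germ_surjective : Function.Surjective (Filter.Germ.coeRingHom (R := L) (U : Filter ι)) :=
  fun f => Filter.Germ.inductionOn f fun f => ⟨f, rfl⟩

/-- Łoś's theorem by hand: lift the coefficients and endpoints to functions and choose a root at
each index, with `0` at the indices where the sign hypotheses fail. -/
instance hasPolyIVT_germ [HasPolyIVT L] : HasPolyIVT (Filter.Germ (U : Filter ι) L) where
  exists_root p a b hab ha hb := by
    obtain ⟨P, rfl⟩ := Polynomial.map_surjective _ (germ_surjective U) p
    obtain ⟨a, rfl⟩ := germ_surjective U a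
    obtain ⟨b, rfl⟩ := germ_surjective U b
    have heval : ∀ (c : ι → L) (i : ι), (P.eval c) i = (P.map (Pi.evalRingHom _ i)).eval (c i) := by
      intro c i
      exact (Polynomial.eval_map_apply (Pi.evalRingHom (fun _ => L) i) c).symm
    rw [Polynomial.eval_map_apply] at ha hb
    have hab' : ∀ᶠ i in (U : Filter ι), a i ≤ b i := Filter.Germ.coe_le.1 hab
    have ha' : ∀ᶠ i in (U : Filter ι), (P.eval a) i ≤ 0 := Filter.Germ.coe_le.1 ha
    have hb' : ∀ᶠ i in (U : Filter ι), 0 ≤ (P.eval b) i := Filter.Germ.coe_le.1 hb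
    have hex : ∀ i, ∃ c, a i ≤ b i → (P.eval a) i ≤ 0 → 0 ≤ (P.eval b) i →
        a i ≤ c ∧ c ≤ b i ∧ (P.map (Pi.evalRingHom _ i)).eval c = 0 := by
      intro i
      by_cases h : a i ≤ b i ∧ (P.eval a) i ≤ 0 ∧ 0 ≤ (P.eval b) i
      · obtain ⟨c, hc⟩ := HasPolyIVT.exists_root (P.map (Pi.evalRingHom _ i)) (a i) (b i) h.1
          (by rw [← heval]; exact h.2.1) (by rw [← heval]; exact h.2.2)
        exact ⟨c, fun _ _ _ => hc⟩
      · exact ⟨0, fun h1 h2 h3 => (h ⟨h1, h2, h3⟩).elim⟩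
    choose c hc using hex
    refine ⟨Filter.Germ.coeRingHom (U : Filter ι) c, Filter.Germ.coe_le.2 ?_,
      Filter.Germ.coe_le.2 ?_, ?_⟩
    · filter_upwards [hab', ha', hb'] with i h1 h2 h3 using (hc i h1 h2 h3).1
    · filter_upwards [hab', ha', hb'] with i h1 h2 h3 using (hc i h1 h2 h3).2.1
    · rw [Polynomial.eval_map_apply]
      refine Filter.Germ.coe_eq.2 ?_
      filter_upwards [hab', ha', hb'] with i h1 h2 h3
      rw [heval]
      exact (hc i h1 h2 h3).2.2

omit [IsStrictOrderedRing L] in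
theorem sameSign_germ_iff {K : Type*} [Field K] [LinearOrder K] {a : K} {f : ι → L} :
    SameSign a (Filter.Germ.coeRingHom (U : Filter ι) f) ↔
      ∀ᶠ i in (U : Filter ι), SameSign a (f i) := by
  have h1 : (0 < Filter.Germ.coeRingHom (U : Filter ι) f) ↔ ∀ᶠ i in (U : Filter ι), 0 < f i :=
    Filter.Germ.coe_pos
  have h2 : (Filter.Germ.coeRingHom (U : Filter ι) f < 0) ↔ ∀ᶠ i in (U : Filter ι), f i < 0 :=
    Filter.Germ.coe_lt (g := fun _ => 0)
  unfold SameSign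
  rw [h1, h2, Filter.eventually_and]
  refine and_congr ?_ ?_
  · by_cases h : 0 < a <;> simp only [h, true_iff, false_iff, Ultrafilter.eventually_not]
  · by_cases h : a < 0 <;> simp only [h, true_iff, false_iff, Ultrafilter.eventually_not]

end Ultrapower

/-- Sign conditions on finitely many polynomials that can be realized in one ordered field with
the intermediate value property can be realized in every other one. -/
theorem exists_sameSign_mvPolynomial {K : Type} [Field K] [LinearOrder K] [IsStrictOrderedRing K]
    [HasPolyIVT K] (n : ℕ) :
    ∀ {D L : Type} [CommRing D] [Field L] [LinearOrder L] [IsStrictOrderedRing L] [HasPolyIVT L]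
      {φ : D →+* K} {ψ : D →+* L} (_ : ∀ a, SameSign (φ a) (ψ a))
      (Γ : Finset (MvPolynomial (Fin n) D)) (ξ : Fin n → K),
      ∃ x : Fin n → L, ∀ p ∈ Γ, SameSign (p.eval₂ φ ξ) (p.eval₂ ψ x) := by
  classical
  induction n with
  | zero =>
    intro D L _ _ _ _ _ φ ψ hφψ Γ ξ
    refine ⟨Fin.elim0, fun p _ => ?_⟩
    rw [MvPolynomial.eq_C_of_isEmpty p, MvPolynomial.eval₂_C, MvPolynomial.eval₂_C]
    exact hφψ _
  | succ n ih =>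
    intro D L _ _ _ _ _ φ ψ hφψ Γ ξ
    -- A point of `L` matches `ξ 0` only for finitely many polynomials at once. Along an ultrafilter
    -- containing all cones of finite sets, the class of `y` matches it for all of `D[X]`, as the
    -- induction hypothesis requires.
    choose y hy using fun i : Finset (Polynomial D) => exists_sameSign hφψ i (ξ 0)
    let U : Ultrafilter (Finset (Polynomial D)) := Ultrafilter.of Filter.atTop
    have hU : (U : Filter (Finset (Polynomial D))) ≤ Filter.atTop := Ultrafilter.of_le _
    let Ψ : Polynomial D →+* (Finset (Polynomial D) → L) :=
      RingHom.pi fun i => Polynomial.eval₂RingHom ψ (y i)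
    have hΨ : ∀ a, SameSign (Polynomial.eval₂RingHom φ (ξ 0) a)
        (((Filter.Germ.coeRingHom (U : Filter _)).comp Ψ) a) := by
      intro a
      rw [RingHom.comp_apply, sameSign_germ_iff]
      filter_upwards [hU (Filter.eventually_ge_atTop {a})] with i hi
      exact hy i a (hi (Finset.mem_singleton_self a))
    let g : MvPolynomial (Fin (n + 1)) D →+* MvPolynomial (Fin n) (Polynomial D) :=
      MvPolynomial.eval₂Hom (MvPolynomial.C.comp Polynomial.C)
        (Fin.cons (MvPolynomial.C Polynomial.X) MvPolynomial.X)
    have hg : ∀ {E : Type} [Field E] (θ : D →+* E) (x₀ : E) (x : Fin n → E)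
        (p : MvPolynomial (Fin (n + 1)) D),
        (g p).eval₂ (Polynomial.eval₂RingHom θ x₀) x = p.eval₂ θ (Fin.cons x₀ x) := by
      intro E _ θ x₀ x p
      have : (MvPolynomial.eval₂Hom (Polynomial.eval₂RingHom θ x₀) x).comp g =
          MvPolynomial.eval₂Hom θ (Fin.cons x₀ x) := by
        apply MvPolynomial.ringHom_ext
        · intro r
          simp [g]
        · intro i
          refine Fin.cases ?_ (fun i => ?_) i <;> simp [g]
      exact congrArg (fun h => h p) this
    obtain ⟨x, hx⟩ := ih hΨ (Γ.image g) (fun i => ξ i.succ)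
    choose z hz using fun j => germ_surjective U (x j)
    have hev : ∀ p ∈ Γ, ∀ᶠ i in (U : Filter _),
        SameSign (p.eval₂ φ ξ) (p.eval₂ ψ (Fin.cons (y i) fun j => z j i)) := by
      intro p hp
      have h1 := hx _ (Finset.mem_image_of_mem g hp)
      have h2 : (g p).eval₂ ((Filter.Germ.coeRingHom (U : Filter _)).comp Ψ) x =
          Filter.Germ.coeRingHom (U : Filter _) ((g p).eval₂ Ψ z) := by
        rw [MvPolynomial.eval₂_comp_left]
        congr 1
        exact funext fun j => (hz j).symm
      have h3 : ∀ i, ((g p).eval₂ Ψ z) i = p.eval₂ ψ (Fin.cons (y i) fun j => z j i) := by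
        intro i
        rw [← hg ψ]
        exact MvPolynomial.eval₂_comp_left (Pi.evalRingHom (fun _ => L) i) Ψ z (g p)
      rw [h2, sameSign_germ_iff, hg] at h1
      filter_upwards [h1] with i hi
      rw [← h3]
      convert hi
      exact (Fin.cons_self_tail ξ).symm
    -- As `Γ` is finite, one index serves for all of `Γ`, and the point comes back to `L`.
    obtain ⟨i, hi⟩ := ((Filter.eventually_all_finset Γ).2 hev).exists
    exact ⟨_, hi⟩

/-! ### Artin–Schreier theory: ordered extensions with polynomial intermediate values -/

section

open Polynomial

instance hasPolyIVT_real : HasPolyIVT ℝ where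
  exists_root p a b hab ha hb := by
    obtain ⟨c, hc, hc'⟩ := intermediate_value_Icc hab p.continuous.continuousOn ⟨ha, hb⟩
    exact ⟨c, hc.1, hc.2, hc'⟩

section SignChange

variable {E : Type*} [Field E] [LinearOrder E]

/-- Sums of squares of polynomials with non-negative coefficients. -/
def weightedSumSq (E : Type*) [Field E] [LinearOrder E] [IsStrictOrderedRing E] :
    Submonoid E[X] where
  carrier := {g | ∃ c f, 0 ≤ c ∧ g = C c * (f * f)}
  one_mem' := ⟨1, 1, zero_le_one, by simp⟩
  mul_mem' := by
    rintro _ _ ⟨c, f, hc, rfl⟩ ⟨d, g, hd, rfl⟩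
    exact ⟨c * d, f * g, mul_nonneg hc hd, by rw [C_mul]; ring⟩

variable [IsStrictOrderedRing E]

theorem eval_nonneg_of_mem_weightedSumSq {s : E[X]}
    (hs : s ∈ (weightedSumSq E).subsemiringClosure) (a : E) : 0 ≤ s.eval a := by
  rw [Submonoid.subsemiringClosure_mem] at hs
  induction hs using AddSubmonoid.closure_induction with
  | mem x hx =>
    obtain ⟨c, f, hc, rfl⟩ := hx
    simpa using mul_nonneg hc (mul_self_nonneg _)
  | zero => simp
  | add x y _ _ hx hy => simpa using add_nonneg hx hy

/-- Each squared polynomial is replaced by its remainder modulo `p`. -/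
theorem exists_natDegree_le_of_mem_weightedSumSq {s p : E[X]} (hp : p.natDegree ≠ 0)
    (hs : s ∈ (weightedSumSq E).subsemiringClosure) :
    ∃ t ∈ (weightedSumSq E).subsemiringClosure, p ∣ s - t ∧
      t.natDegree ≤ 2 * (p.natDegree - 1) := by
  rw [Submonoid.subsemiringClosure_mem] at hs
  induction hs using AddSubmonoid.closure_induction with
  | mem x hx =>
    obtain ⟨c, f, hc, rfl⟩ := hx
    refine ⟨C c * ((f % p) * (f % p)), ?_, ?_, ?_⟩
    · rw [Submonoid.subsemiringClosure_mem]
      exact AddSubmonoid.subset_closure ⟨c, f % p, hc, rfl⟩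
    · refine ⟨C c * (f / p) * (f + f % p), ?_⟩
      have h := EuclideanDomain.mod_add_div f p
      have h' : f - f % p = p * (f / p) := by linear_combination -h
      linear_combination C c * (f + f % p) * h'
    · have h1 := natDegree_mod_lt f hp
      have h2 : (C c * ((f % p) * (f % p))).natDegree ≤ ((f % p) * (f % p)).natDegree :=
        natDegree_C_mul_le _ _
      have h3 : ((f % p) * (f % p)).natDegree ≤ (f % p).natDegree + (f % p).natDegree :=
        natDegree_mul_le
      omega
  | zero => exact ⟨0, zero_mem _, by simp, by simp⟩
  | add x y _ _ hx hy =>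
    obtain ⟨t, ht, h1, h2⟩ := hx
    obtain ⟨u, hu, h3, h4⟩ := hy
    exact ⟨t + u, add_mem ht hu, by rw [add_sub_add_comm]; exact dvd_add h1 h3,
      (natDegree_add_le _ _).trans (max_le h2 h4)⟩

/-- `-1` is not a weighted sum of squares modulo a polynomial that changes its sign. -/
theorem not_dvd_one_add_of_sign_change {a b : E} (d : ℕ) : ∀ p : E[X], p.natDegree = d →
    p.eval a * p.eval b < 0 → ∀ s ∈ (weightedSumSq E).subsemiringClosure, ¬ p ∣ 1 + s := by
  induction d using Nat.strong_induction_on with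
  | _ d ih =>
    intro p hd hp s hs hdvd
    have hp0 : p.natDegree ≠ 0 := by
      intro h
      obtain ⟨c, rfl⟩ := natDegree_eq_zero.1 h
      simp only [eval_C] at hp
      exact (mul_self_nonneg c).not_gt hp
    obtain ⟨t, ht, h1, h2⟩ := exists_natDegree_le_of_mem_weightedSumSq hp0 hs
    -- Descent: in `1 + t = p h` the left side is positive everywhere, so `h` changes sign with `p`,
    -- while `deg h ≤ deg p - 2`.
    obtain ⟨h, hh⟩ : p ∣ 1 + t := by
      have := dvd_sub hdvd h1
      rwa [show 1 + s - (s - t) = 1 + t by ring] at this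
    have hpos : ∀ c, 0 < p.eval c * h.eval c := fun c => by
      rw [← eval_mul, ← hh]
      have := eval_nonneg_of_mem_weightedSumSq ht c
      simp only [eval_add, eval_one]
      positivity
    have hne : 1 + t ≠ 0 := by
      intro h0
      have := hpos a
      rw [← eval_mul, ← hh, h0] at this
      simp at this
    have hdeg : (1 + t).natDegree ≤ 2 * (p.natDegree - 1) :=
      (natDegree_add_le _ _).trans (max_le (by simp) h2)
    rw [hh, natDegree_mul (by rintro rfl; simp at hp0) (by rintro rfl; simp at hh; exact hne hh)]
      at hdeg
    refine ih h.natDegree (by omega) h rfl ?_ t ht ⟨p, by rw [hh, mul_comm]⟩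
    have := mul_pos (hpos a) (hpos b)
    by_contra! hn
    nlinarith [mul_nonneg hn (neg_nonneg.2 hp.le)]

/-- An ordered field in which irreducible polynomials that change their sign have roots has the
intermediate value property for polynomials. -/
theorem hasPolyIVT_of_irreducible
    (H : ∀ (p : E[X]) (a b : E), Irreducible p → p.eval a * p.eval b < 0 → ∃ c, p.eval c = 0) :
    HasPolyIVT E where
  exists_root p a b hab ha hb := by
    have key : ∀ p : E[X], p ≠ 0 → p.eval a * p.eval b < 0 → ∃ c, a ≤ c ∧ c ≤ b ∧ p.eval c = 0 := by
      intro p hp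
      induction p using WfDvdMonoid.induction_on_irreducible with
      | zero => exact (hp rfl).elim
      | unit u hu =>
        obtain ⟨c, -, rfl⟩ := Polynomial.isUnit_iff.1 hu
        intro h
        simp only [eval_C] at h
        exact ((mul_self_nonneg c).not_gt h).elim
      | mul p q hp0 hq ih =>
        intro h
        -- A sign-changing irreducible factor has a root, hence is linear, and its root lies between
        -- `a` and `b`. Otherwise the cofactor changes sign.
        by_cases hqs : q.eval a * q.eval b < 0
        · obtain ⟨c, hc⟩ := H q a b hq hqs
          have hdeg := degree_eq_one_of_irreducible_of_root hq hc
          obtain ⟨r, hr⟩ := dvd_iff_isRoot.2 hc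
          have hr0 : r.natDegree = 0 := by
            have h1 : q.natDegree = 1 := natDegree_eq_of_degree_eq_some hdeg
            have hr0 : r ≠ 0 := by rintro rfl; simp [hr] at hqs
            rw [hr, natDegree_mul (X_sub_C_ne_zero c) hr0, natDegree_X_sub_C] at h1
            omega
          obtain ⟨u, rfl⟩ := natDegree_eq_zero.1 hr0
          rw [hr] at hqs
          simp only [eval_mul, eval_sub, eval_X, eval_C] at hqs
          have hu : 0 < u * u := by
            refine lt_of_le_of_ne (mul_self_nonneg u) fun h0 => ?_
            rw [mul_self_eq_zero.1 h0.symm] at hqs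
            simp at hqs
          have hab' : (a - c) * (b - c) < 0 := by
            by_contra! hn
            nlinarith [mul_nonneg hn hu.le]
          refine ⟨c, ?_, ?_, by simp [show q.eval c = 0 from hc]⟩
          · rcases mul_neg_iff.1 hab' with h | h <;> linarith
          · rcases mul_neg_iff.1 hab' with h | h <;> linarith
        · obtain ⟨c, h1, h2, h3⟩ := ih hp0 (by
            simp only [eval_mul] at h
            by_contra! hn
            push Not at hqs
            nlinarith [mul_nonneg hn hqs])
          exact ⟨c, h1, h2, by simp [h3]⟩
    rcases ha.eq_or_lt with h | ha
    · exact ⟨a, le_rfl, hab, h⟩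
    rcases hb.eq_or_lt with h | hb
    · exact ⟨b, hab, le_rfl, h.symm⟩
    exact key p (by rintro rfl; simp at ha) (mul_neg_of_neg_of_pos ha hb)

end SignChange

/-- The subsemiring `P + x P`, for `x` with `x² ∈ P`. -/
def adjoinElement {R : Type*} [CommRing R] (P : Subsemiring R) (x : R) (hx : x * x ∈ P) :
    Subsemiring R where
  carrier := {y | ∃ a ∈ P, ∃ b ∈ P, y = a + x * b}
  zero_mem' := ⟨0, zero_mem _, 0, zero_mem _, by simp⟩
  one_mem' := ⟨1, one_mem _, 0, zero_mem _, by simp⟩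
  add_mem' := by
    rintro _ _ ⟨a, ha, b, hb, rfl⟩ ⟨c, hc, d, hd, rfl⟩
    exact ⟨a + c, add_mem ha hc, b + d, add_mem hb hd, by ring⟩
  mul_mem' := by
    rintro _ _ ⟨a, ha, b, hb, rfl⟩ ⟨c, hc, d, hd, rfl⟩
    exact ⟨a * c + x * x * (b * d), add_mem (mul_mem ha hc)
      (mul_mem hx (mul_mem hb hd)), a * d + b * c,
      add_mem (mul_mem ha hd) (mul_mem hb hc), by ring⟩

section RealClosure

variable {F Ω : Type*} [Field F] [Field Ω] [Algebra F Ω]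

/-- Subsemirings of `Ω` that contain the image of `T` and define a preordering of the subring of
their differences. -/
structure IsPositiveCone (T : RingPreordering F) (P : Subsemiring Ω) : Prop where
  map_mem : ∀ a ∈ T, algebraMap F Ω a ∈ P
  sq_mem : ∀ a ∈ P, ∀ b ∈ P, (a - b) * (a - b) ∈ P
  neg_one_notMem : -1 ∉ P

theorem exists_maximal_isPositiveCone (T : RingPreordering F) :
    ∃ P : Subsemiring Ω, Maximal (IsPositiveCone T) P := by
  have h0 : IsPositiveCone T (T.toSubsemiring.map (algebraMap F Ω)) := by
    refine ⟨fun a ha => ⟨a, ha, rfl⟩, ?_, ?_⟩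
    · rintro _ ⟨a, ha, rfl⟩ _ ⟨b, hb, rfl⟩
      exact ⟨(a - b) * (a - b), T.mul_self_mem _, by simp⟩
    · rintro ⟨a, ha, h⟩
      have : a = -1 := (algebraMap F Ω).injective (by simpa using h)
      exact T.neg_one_notMem (this ▸ ha)
  obtain ⟨P, -, hP⟩ := zorn_le_nonempty₀ {P : Subsemiring Ω | IsPositiveCone T P} (by
    intro c hc hchain y hy
    have hmem : ∀ {x}, x ∈ sSup c ↔ ∃ P ∈ c, x ∈ P :=
      Subsemiring.mem_sSup_of_directedOn ⟨y, hy⟩ hchain.directedOn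
    refine ⟨sSup c, ⟨fun a ha => hmem.2 ⟨y, hy, (hc hy).map_mem a ha⟩, ?_, ?_⟩,
      fun z hz => le_sSup hz⟩
    · intro a ha b hb
      obtain ⟨P, hP, ha⟩ := hmem.1 ha
      obtain ⟨Q, hQ, hb⟩ := hmem.1 hb
      rcases hchain.total hP hQ with h | h
      · exact hmem.2 ⟨Q, hQ, (hc hQ).sq_mem a (h ha) b hb⟩
      · exact hmem.2 ⟨P, hP, (hc hP).sq_mem a ha b (h hb)⟩
    · intro h
      obtain ⟨P, hP, h⟩ := hmem.1 h
      exact (hc hP).neg_one_notMem h) _ h0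
  exact ⟨P, hP⟩

variable {T : RingPreordering F} {P : Subsemiring Ω}

theorem IsPositiveCone.exists_sub [CharZero F] (h : IsPositiveCone T P) (x : F) :
    ∃ a ∈ P, ∃ b ∈ P, algebraMap F Ω x = a - b := by
  -- `x = ((x + 1)/2)² - ((x - 1)/2)²`.
  refine ⟨_, h.map_mem _ (T.mul_self_mem ((x + 1) / 2)), _,
    h.map_mem _ (T.mul_self_mem ((x - 1) / 2)), ?_⟩
  rw [← map_sub]
  congr 1
  ring

variable [CharZero F]

/-- The subalgebra of differences of elements of a positive cone. -/
def IsPositiveCone.differences (h : IsPositiveCone T P) : Subalgebra F Ω where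
  carrier := {x | ∃ a ∈ P, ∃ b ∈ P, x = a - b}
  mul_mem' := by
    rintro _ _ ⟨a, ha, b, hb, rfl⟩ ⟨c, hc, d, hd, rfl⟩
    exact ⟨a * c + b * d, add_mem (mul_mem ha hc) (mul_mem hb hd), a * d + b * c,
      add_mem (mul_mem ha hd) (mul_mem hb hc), by ring⟩
  add_mem' := by
    rintro _ _ ⟨a, ha, b, hb, rfl⟩ ⟨c, hc, d, hd, rfl⟩
    exact ⟨a + c, add_mem ha hc, b + d, add_mem hb hd, by ring⟩
  algebraMap_mem' := h.exists_sub

/-- The field of differences of elements of a positive cone in an algebraic extension. -/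
def IsPositiveCone.field [Algebra.IsAlgebraic F Ω] (h : IsPositiveCone T P) :
    IntermediateField F Ω :=
  h.differences.toIntermediateField fun x hx =>
    h.differences.inv_mem_of_algebraic (x := ⟨x, hx⟩) (Algebra.IsAlgebraic.isAlgebraic x)

variable [Algebra.IsAlgebraic F Ω]

theorem IsPositiveCone.mem_field (h : IsPositiveCone T P) {x : Ω} :
    x ∈ h.field ↔ ∃ a ∈ P, ∃ b ∈ P, x = a - b := Iff.rfl

theorem IsPositiveCone.le_field (h : IsPositiveCone T P) {x : Ω} (hx : x ∈ P) : x ∈ h.field :=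
  h.mem_field.2 ⟨x, hx, 0, zero_mem _, by simp⟩

theorem IsPositiveCone.mul_self_mem (h : IsPositiveCone T P) {x : Ω} (hx : x ∈ h.field) :
    x * x ∈ P := by
  obtain ⟨a, ha, b, hb, rfl⟩ := h.mem_field.1 hx
  exact h.sq_mem a ha b hb

/-- Either `P + xP` is still a positive cone and maximality gives `x ∈ P`, or `-1 = a + x b`, and
then `-x = (1 + a) b / b²` is in `P`. -/
theorem mem_or_neg_mem_of_maximal (hP : Maximal (IsPositiveCone T) P) {x : Ω}
    (hx : x ∈ hP.prop.field) : x ∈ P ∨ -x ∈ P := by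
  have h := hP.prop
  by_cases h1 : ∃ a ∈ P, ∃ b ∈ P, (-1 : Ω) = a + x * b
  · obtain ⟨a, ha, b, hb, hab⟩ := h1
    right
    have hb0 : b ≠ 0 := by
      rintro rfl
      rw [mul_zero, add_zero] at hab
      exact h.neg_one_notMem (hab ▸ ha)
    have : -x = (1 + a) * b * (b⁻¹ * b⁻¹) := by
      field_simp
      linear_combination hab
    rw [this]
    exact mul_mem (mul_mem (add_mem (one_mem _) ha) hb)
      (h.mul_self_mem (inv_mem (h.le_field hb)))
  · left
    push Not at h1
    let Q : Subsemiring Ω := adjoinElement P x (h.mul_self_mem hx)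
    have hPQ : P ≤ Q := fun y hy => ⟨y, hy, 0, zero_mem _, by simp⟩
    have hQE : ∀ y ∈ Q, y ∈ h.field := by
      rintro _ ⟨a, ha, b, hb, rfl⟩
      exact add_mem (h.le_field ha) (mul_mem hx (h.le_field hb))
    have hQ : IsPositiveCone T Q :=
      ⟨fun a ha => hPQ (h.map_mem a ha),
        fun a ha b hb => hPQ (h.mul_self_mem (sub_mem (hQE a ha) (hQE b hb))),
        by rintro ⟨a, ha, b, hb, hab⟩; exact h1 a ha b hb hab⟩
    exact hP.le_of_ge hQ hPQ ⟨0, zero_mem _, 1, one_mem _, by simp⟩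

/-- The ring cone that a maximal positive cone induces on its field of differences. -/
def coneOfMaximal (hP : Maximal (IsPositiveCone T) P) : RingCone hP.prop.field where
  __ := P.comap (algebraMap hP.prop.field Ω)
  eq_zero_of_mem_of_neg_mem' := by
    intro x hx hnx
    by_contra h0
    apply hP.prop.neg_one_notMem
    have h1 : (x : Ω) ∈ P := hx
    have h2 : -(x : Ω) ∈ P := hnx
    have h3 : (x : Ω) ≠ 0 := by simpa using h0
    have : (-1 : Ω) = x * -x * ((x : Ω)⁻¹ * (x : Ω)⁻¹) := by field_simp
    rw [this]
    exact mul_mem (mul_mem h1 h2) (hP.prop.mul_self_mem (inv_mem x.2))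

instance (hP : Maximal (IsPositiveCone T) P) : HasMemOrNegMem (coneOfMaximal hP) where
  mem_or_neg_mem x := mem_or_neg_mem_of_maximal hP x.2

open Classical in
/-- The linear order that a maximal positive cone induces on its field of differences. -/
noncomputable abbrev linearOrderOfMaximal (hP : Maximal (IsPositiveCone T) P) :
    LinearOrder hP.prop.field := LinearOrder.mkOfAddGroupCone (coneOfMaximal hP)

theorem isStrictOrderedRing_of_maximal (hP : Maximal (IsPositiveCone T) P) :
    letI := linearOrderOfMaximal hP
    IsStrictOrderedRing hP.prop.field := by
  let _ := linearOrderOfMaximal hP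
  have : IsOrderedRing hP.prop.field := IsOrderedRing.mkOfCone (coneOfMaximal hP)
  exact IsOrderedRing.toIsStrictOrderedRing _

theorem nonneg_iff_of_maximal (hP : Maximal (IsPositiveCone T) P) (x : hP.prop.field) :
    letI := linearOrderOfMaximal hP
    0 ≤ x ↔ (x : Ω) ∈ P := by
  let _ := linearOrderOfMaximal hP
  change x - 0 ∈ coneOfMaximal hP ↔ _
  rw [sub_zero]
  rfl

/-- If `x ∈ Ω` is a root of an irreducible `p` that changes sign, the order extends to a positive
cone containing all squares of values `f(x)`. Maximality forces these squares into `P`, whence `x`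
already lies in the field of differences. -/
theorem hasPolyIVT_of_maximal [IsAlgClosed Ω] (hP : Maximal (IsPositiveCone T) P) :
    letI := linearOrderOfMaximal hP
    HasPolyIVT hP.prop.field := by
  let _ := linearOrderOfMaximal hP
  have := isStrictOrderedRing_of_maximal hP
  have h := hP.prop
  apply hasPolyIVT_of_irreducible
  intro p a b hp hab
  obtain ⟨x, hx⟩ := IsAlgClosed.exists_aeval_eq_zero Ω p hp.degree_pos.ne'
  let Q : Subsemiring Ω := (weightedSumSq hP.prop.field).subsemiringClosure.map
    (aeval x : hP.prop.field[X] →ₐ[hP.prop.field] Ω).toRingHom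
  have hmem : ∀ c : hP.prop.field, 0 ≤ c → ∀ f : hP.prop.field[X],
      (c : Ω) * (aeval x f * aeval x f) ∈ Q := by
    intro c hc f
    refine ⟨C c * (f * f), ?_, by simp [IntermediateField.algebraMap_apply]⟩
    rw [SetLike.mem_coe, Submonoid.subsemiringClosure_mem]
    exact AddSubmonoid.subset_closure ⟨c, f, hc, rfl⟩
  have hPQ : P ≤ Q := fun y hy => by
    simpa using hmem ⟨y, h.le_field hy⟩ ((nonneg_iff_of_maximal hP _).2 hy) 1
  have hQ : IsPositiveCone T Q := by
    refine ⟨fun a ha => hPQ (h.map_mem a ha), ?_, ?_⟩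
    · rintro _ ⟨f, -, rfl⟩ _ ⟨g, -, rfl⟩
      simpa using hmem 1 zero_le_one (f - g)
    · rintro ⟨s, hs, hs'⟩
      have h0 : aeval x (1 + s) = 0 := by
        have : aeval x s = -1 := hs'
        simp [this]
      have hdvd : p ∣ 1 + s := by
        have h1 := minpoly.dvd hP.prop.field x h0
        have h2 := minpoly.dvd hP.prop.field x hx
        have hint : IsIntegral hP.prop.field x :=
          (isAlgebraic_iff_isIntegral).1 ⟨p, hp.ne_zero, hx⟩
        exact ((minpoly.irreducible hint).associated_of_dvd hp h2).symm.dvd.trans h1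
      exact not_dvd_one_add_of_sign_change _ p rfl hab s hs hdvd
  have hQP := hP.le_of_ge hQ hPQ
  have hxE : x ∈ hP.prop.field := by
    -- Again `x = ((x + 1)/2)² - ((x - 1)/2)²`, now a difference of elements of `P`.
    have h1 := hQP (hmem 1 zero_le_one (C (1 / 2) * (X + 1)))
    have h2 := hQP (hmem 1 zero_le_one (C (1 / 2) * (X - 1)))
    refine h.mem_field.2 ⟨_, h1, _, h2, ?_⟩
    have : CharZero Ω := charZero_of_injective_algebraMap (algebraMap F Ω).injective
    have h2 : ((2 : hP.prop.field) : Ω) = 2 := rfl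
    simp [h2]
    ring
  refine ⟨(⟨x, hxE⟩ : hP.prop.field), ?_⟩
  have : aeval ((⟨x, hxE⟩ : hP.prop.field) : Ω) p = 0 := hx
  have h3 := (aeval_algebraMap_apply_eq_algebraMap_eval (A := Ω)
    (⟨x, hxE⟩ : hP.prop.field) p).symm.trans this
  simpa using h3

end RealClosure

/-- A field with a preordering maps to an ordered field with the intermediate value property for
polynomials, in such a way that the preordering becomes non-negative. -/
theorem exists_polyIVT_extension {F : Type} [Field F] [CharZero F] (T : RingPreordering F) :
    ∃ (E : Type) (_ : Field E) (_ : LinearOrder E) (_ : IsStrictOrderedRing E) (_ : HasPolyIVT E)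
      (φ : F →+* E), ∀ a ∈ T, 0 ≤ φ a := by
  obtain ⟨P, hP⟩ := exists_maximal_isPositiveCone (Ω := AlgebraicClosure F) T
  let _ := linearOrderOfMaximal hP
  exact ⟨hP.prop.field, inferInstance, inferInstance, isStrictOrderedRing_of_maximal hP,
    hasPolyIVT_of_maximal hP, algebraMap F _,
    fun a ha => (nonneg_iff_of_maximal hP _).2 (hP.prop.map_mem a ha)⟩

end

/-! ### Orderings of rings and the Positivstellensatz -/

section Preordering

variable {A : Type*} [CommRing A]

/-- Take `P` maximal by Zorn. If neither `x` nor `y` is in `P`, then `-1 = a + x b = c + y d`, and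
`(1 + a)(1 + c) = xy · bd` would give `-1 ∈ P` if `-(xy)` were in `P`. -/
theorem exists_isOrdering (T : Subsemiring A) (hsq : ∀ x, x * x ∈ T) (hT : -1 ∉ T) :
    ∃ P : RingPreordering A, T ≤ P.toSubsemiring ∧ ∀ a b : A, -(a * b) ∈ P → a ∈ P ∨ b ∈ P := by
  obtain ⟨P, hTP, hP⟩ := zorn_le_nonempty₀ {P : Subsemiring A | T ≤ P ∧ -1 ∉ P} (by
    intro c hc hchain y hy
    have hmem : ∀ {x}, x ∈ sSup c ↔ ∃ P ∈ c, x ∈ P :=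
      Subsemiring.mem_sSup_of_directedOn ⟨y, hy⟩ hchain.directedOn
    refine ⟨sSup c, ⟨(hc hy).1.trans (le_sSup hy), fun h => ?_⟩, fun z hz => le_sSup hz⟩
    obtain ⟨P, hP, h⟩ := hmem.1 h
    exact (hc hP).2 h) T ⟨le_rfl, hT⟩
  have hPsq : ∀ x, x * x ∈ P := fun x => hTP (hsq x)
  have key : ∀ x, x ∉ P → ∃ a ∈ P, ∃ b ∈ P, -1 = a + x * b := by
    intro x hx
    by_contra hn
    have hle : P ≤ adjoinElement P x (hPsq x) := fun y hy => ⟨y, hy, 0, zero_mem _, by simp⟩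
    exact hx (hP.le_of_ge ⟨hTP.trans hle, hn⟩ hle ⟨0, zero_mem _, 1, one_mem _, by simp⟩)
  refine ⟨RingPreordering.mk' P add_mem mul_mem hPsq hP.prop.2, hTP, fun x y hxy => ?_⟩
  by_contra! hn
  obtain ⟨a, ha, b, hb, hab⟩ := key x hn.1
  obtain ⟨c, hc, d, hd, hcd⟩ := key y hn.2
  apply hP.prop.2
  have : (-1 : A) = a + c + a * c + -(x * y) * (b * d) := by
    linear_combination (1 + c) * hab - x * b * hcd
  rw [this]
  exact add_mem (add_mem (add_mem ha hc) (mul_mem ha hc)) (mul_mem hxy (mul_mem hb hd))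

/-- An ordering of a ring induces an ordering of the residue field of its support. -/
theorem exists_preordering_residueField (P : RingPreordering A) [P.IsOrdering] :
    ∃ T : RingPreordering (FractionRing (A ⧸ P.support)),
      ∀ a ∈ P, algebraMap _ (FractionRing (A ⧸ P.support)) (Ideal.Quotient.mk P.support a) ∈ T := by
  let F := FractionRing (A ⧸ P.support)
  let ι : A →+* F := (algebraMap (A ⧸ P.support) F).comp (Ideal.Quotient.mk P.support)
  have hι : ∀ a, ι a = 0 ↔ a ∈ P.support := fun a => by
    rw [← Ideal.Quotient.eq_zero_iff_mem]
    exact map_eq_zero_iff _ (IsFractionRing.injective (A ⧸ P.support) F)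
  -- The fractions `a / b²` with `a ∈ P`. If `-1` were one, `-b²` would be in `P`, and `b` would be
  -- in the prime support.
  refine ⟨RingPreordering.mk' {x : F | ∃ b, ι b ≠ 0 ∧ ∃ a ∈ P, x * (ι b * ι b) = ι a}
    ?_ ?_ ?_ ?_, fun a ha => ⟨1, by simp, a, ha, ?_⟩⟩
  · rintro x y ⟨b, hb, a, ha, h⟩ ⟨d, hd, c, hc, h'⟩
    refine ⟨b * d, by simp [hb, hd], a * (d * d) + c * (b * b),
      add_mem (mul_mem ha (P.mul_self_mem d)) (mul_mem hc (P.mul_self_mem b)), ?_⟩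
    simp only [map_mul, map_add]
    linear_combination (ι d * ι d) * h + (ι b * ι b) * h'
  · rintro x y ⟨b, hb, a, ha, h⟩ ⟨d, hd, c, hc, h'⟩
    refine ⟨b * d, by simp [hb, hd], a * c, mul_mem ha hc, ?_⟩
    simp only [map_mul]
    linear_combination (y * (ι d * ι d)) * h + ι a * h'
  · intro x
    obtain ⟨u, v, hv, rfl⟩ := IsFractionRing.div_surjective (A := A ⧸ P.support) x
    obtain ⟨u, rfl⟩ := Ideal.Quotient.mk_surjective u
    obtain ⟨v, rfl⟩ := Ideal.Quotient.mk_surjective v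
    have hv0 : ι v ≠ 0 := by
      have := nonZeroDivisors.ne_zero hv
      rw [Ne, Ideal.Quotient.eq_zero_iff_mem] at this
      rwa [Ne, hι]
    refine ⟨v, hv0, u * u, P.mul_self_mem u, ?_⟩
    change ι u / ι v * (ι u / ι v) * (ι v * ι v) = ι (u * u)
    rw [map_mul, div_mul_div_comm, div_mul_cancel₀ _ (mul_ne_zero hv0 hv0)]
  · rintro ⟨b, hb, a, ha, h⟩
    have h0 : a + b * b ∈ P.support := by
      rw [← hι, map_add, map_mul, ← h]
      ring
    have h1 : -(b * b) ∈ P := by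
      have := add_mem h0.2 ha
      rwa [show -(a + b * b) + a = -(b * b) by ring] at this
    have h2 : b * b ∈ P.support := ⟨P.mul_self_mem b, h1⟩
    exact hb ((hι b).2 (((inferInstance : P.support.IsPrime).mem_or_mem h2).elim id id))
  · simp [ι, F]

end Preordering

/-- Positive reals are squares of units, so any ring map respects signs. -/
theorem sameSign_ringHom_real {E : Type*} [Field E] [LinearOrder E] [IsStrictOrderedRing E]
    (φ : ℝ →+* E) (a : ℝ) : SameSign (φ a) a := by
  have key : ∀ b : ℝ, 0 < b → 0 < φ b := by
    intro b hb
    have h0 : φ (√b) ≠ 0 := (map_ne_zero φ).2 (Real.sqrt_pos.2 hb).ne'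
    have := mul_self_pos.2 h0
    rwa [← map_mul, Real.mul_self_sqrt hb.le] at this
  rcases lt_trichotomy a 0 with h | rfl | h
  · have h1 := key (-a) (neg_pos.2 h)
    rw [map_neg, neg_pos] at h1
    exact ⟨by simp [h.not_gt, h1.not_gt], by simp [h, h1]⟩
  · rw [map_zero]; exact sameSign_zero
  · exact sameSign_of_pos (key a h) h

/-- Finitely many elements of a proper preordering of `ℝ[X]` are non-negative at a common real
point. -/
theorem exists_real_point {n : ℕ} (T : Subsemiring (MvPolynomial (Fin n) ℝ))
    (hsq : ∀ x, x * x ∈ T) (hT : -1 ∉ T) (Γ : Finset (MvPolynomial (Fin n) ℝ))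
    (hΓ : ∀ p ∈ Γ, p ∈ T) : ∃ x : Fin n → ℝ, ∀ p ∈ Γ, 0 ≤ MvPolynomial.eval x p := by
  obtain ⟨P, hTP, hP⟩ := exists_isOrdering T hsq hT
  have : P.HasIdealSupport :=
    RingPreordering.hasIdealSupport_of_isUnit_two ⟨⟨2, MvPolynomial.C (1 / 2),
      by rw [← map_ofNat MvPolynomial.C 2, ← map_mul]; norm_num,
      by rw [← map_ofNat MvPolynomial.C 2, ← map_mul]; norm_num⟩, rfl⟩
  have : P.IsOrdering := RingPreordering.isOrdering_iff.2 hP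
  let F := FractionRing (MvPolynomial (Fin n) ℝ ⧸ P.support)
  let ι : MvPolynomial (Fin n) ℝ →+* F :=
    (algebraMap _ F).comp (Ideal.Quotient.mk P.support)
  have : CharZero F := charZero_of_injective_ringHom (ι.comp MvPolynomial.C).injective
  obtain ⟨T', hT'⟩ := exists_preordering_residueField P
  obtain ⟨E, _, _, _, _, φ, hφ⟩ := exists_polyIVT_extension T'
  let θ : MvPolynomial (Fin n) ℝ →+* E := φ.comp ι
  -- Evaluation at the images of the variables is `θ`, which is non-negative on `Γ`. The signs are
  -- transferred from `E` to `ℝ` over the coefficient ring `ℝ`.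
  obtain ⟨x, hx⟩ := exists_sameSign_mvPolynomial n
    (φ := θ.comp MvPolynomial.C) (ψ := RingHom.id ℝ) (sameSign_ringHom_real _) Γ
    (fun i => θ (MvPolynomial.X i))
  refine ⟨x, fun p hp => not_lt.1 fun hneg => ?_⟩
  have h1 := (hx p hp).2.2 hneg
  have h2 : p.eval₂ (θ.comp MvPolynomial.C) (fun i => θ (MvPolynomial.X i)) = θ p := by
    have : MvPolynomial.eval₂Hom (θ.comp MvPolynomial.C) (fun i => θ (MvPolynomial.X i)) = θ := by
      apply MvPolynomial.ringHom_ext <;> intro <;> simp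
    exact congrArg (fun h => h p) this
  rw [h2] at h1
  exact h1.not_ge (hφ _ (hT' p (hTP (hΓ p hp))))

/-! ### Archimedean quadratic modules and Jacobi's theorem -/

/-- Quadratic modules of a commutative ring (not necessarily proper). -/
structure IsQuadraticModule {A : Type*} [CommRing A] (M : AddSubmonoid A) : Prop where
  one_mem : 1 ∈ M
  mul_self_mul_mem : ∀ a, ∀ m ∈ M, a * a * m ∈ M

section QuadraticModule

variable {A : Type*} [CommRing A] {M : AddSubmonoid A}

theorem IsQuadraticModule.mul_self_mem (h : IsQuadraticModule M) (a : A) : a * a ∈ M := by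
  simpa using h.mul_self_mul_mem a 1 h.one_mem

theorem IsQuadraticModule.sumSq_mul_mem (h : IsQuadraticModule M) {s : A} (hs : IsSumSq s)
    {m : A} (hm : m ∈ M) : s * m ∈ M := by
  induction hs with
  | zero => simp
  | sq_add a _ ih => rw [add_mul]; exact add_mem (h.mul_self_mul_mem a m hm) ih

theorem IsQuadraticModule.sumSq_mem (h : IsQuadraticModule M) {s : A} (hs : IsSumSq s) : s ∈ M := by
  simpa using h.sumSq_mul_mem hs h.one_mem

variable [Algebra ℝ A]

theorem IsQuadraticModule.algebraMap_mul_mem (h : IsQuadraticModule M) {r : ℝ} (hr : 0 ≤ r)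
    {m : A} (hm : m ∈ M) : algebraMap ℝ A r * m ∈ M := by
  rw [← Real.mul_self_sqrt hr, map_mul]
  exact h.mul_self_mul_mem _ m hm

theorem IsQuadraticModule.algebraMap_mem (h : IsQuadraticModule M) {r : ℝ} (hr : 0 ≤ r) :
    algebraMap ℝ A r ∈ M := by
  simpa using h.algebraMap_mul_mem hr h.one_mem

theorem IsQuadraticModule.algebraMap_sub_mem_of_le (h : IsQuadraticModule M) {r s : ℝ} (hrs : r ≤ s)
    {a : A} (ha : algebraMap ℝ A r - a ∈ M) : algebraMap ℝ A s - a ∈ M := by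
  have := add_mem (h.algebraMap_mem (sub_nonneg.2 hrs)) ha
  rwa [map_sub, sub_add_sub_cancel] at this

/-- The elements that are bounded with respect to a quadratic module form a subalgebra. -/
def IsQuadraticModule.bounded (h : IsQuadraticModule M) : Subalgebra ℝ A where
  carrier := {a | ∃ k : ℝ, algebraMap ℝ A k - a * a ∈ M}
  algebraMap_mem' r := ⟨r * r, by simp⟩
  add_mem' := by
    rintro a b ⟨k, hk⟩ ⟨l, hl⟩
    refine ⟨2 * (k + l), ?_⟩
    have := add_mem (add_mem (add_mem hk hk) (add_mem hl hl)) (h.mul_self_mem (a - b))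
    convert this using 1
    simp only [map_mul, map_add, map_ofNat]
    ring
  mul_mem' := by
    rintro a b ⟨k, hk⟩ ⟨l, hl⟩
    -- In `kl - a²b² = b²(k - a²) + k(l - b²)` the factor `k` must be non-negative.
    replace hk := h.algebraMap_sub_mem_of_le (le_max_left k 0) hk
    have := add_mem (h.mul_self_mul_mem b _ hk) (h.algebraMap_mul_mem (le_max_right k 0) hl)
    refine ⟨max k 0 * l, ?_⟩
    convert this using 1
    rw [map_mul]
    ring

/-- `k + 1/4 - a = (k - a²) + (a - 1/2)²`. -/
theorem IsQuadraticModule.exists_sub_mem (h : IsQuadraticModule M) {a : A} (ha : a ∈ h.bounded) :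
    ∃ k : ℝ, algebraMap ℝ A k - a ∈ M := by
  obtain ⟨k, hk⟩ := ha
  refine ⟨k + 1 / 4, ?_⟩
  have h2 : algebraMap ℝ A (1 / 2) * 2 = 1 := by
    rw [← map_ofNat (algebraMap ℝ A) 2, ← map_mul]; norm_num
  have h4 : algebraMap ℝ A (1 / 4) = algebraMap ℝ A (1 / 2) * algebraMap ℝ A (1 / 2) := by
    rw [← map_mul]; norm_num
  convert add_mem hk (h.mul_self_mem (a - algebraMap ℝ A (1 / 2))) using 1
  rw [map_add, h4]
  linear_combination a * h2

theorem IsQuadraticModule.exists_sub_mem_of_mvPolynomial {σ : Type*} [Fintype σ]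
    {M : AddSubmonoid (MvPolynomial σ ℝ)} (h : IsQuadraticModule M) {N : ℝ}
    (hN : MvPolynomial.C N - ∑ i, MvPolynomial.X i * MvPolynomial.X i ∈ M)
    (p : MvPolynomial σ ℝ) : ∃ k : ℝ, MvPolynomial.C k - p ∈ M := by
  classical
  have hX : ∀ i, (MvPolynomial.X i : MvPolynomial σ ℝ) ∈ h.bounded := by
    intro i
    refine ⟨N, ?_⟩
    have h1 := add_mem hN (sum_mem (t := Finset.univ.erase i)
      (fun j _ => h.mul_self_mem (MvPolynomial.X j)))
    rw [← Finset.add_sum_erase _ _ (Finset.mem_univ i)] at h1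
    convert h1 using 1
    rw [MvPolynomial.algebraMap_eq]
    ring
  refine h.exists_sub_mem ?_
  have : Algebra.adjoin ℝ (Set.range (MvPolynomial.X : σ → MvPolynomial σ ℝ)) ≤ h.bounded :=
    Algebra.adjoin_le (by rintro _ ⟨i, rfl⟩; exact hX i)
  rw [MvPolynomial.adjoin_range_X] at this
  exact this trivial

omit [Algebra ℝ A] in
/-- The quadratic module generated by `M` and `a`. -/
def IsQuadraticModule.adjoin (_ : IsQuadraticModule M) (a : A) : AddSubmonoid A where
  carrier := {x | ∃ m ∈ M, ∃ s, IsSumSq s ∧ x = m + s * a}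
  zero_mem' := ⟨0, zero_mem _, 0, IsSumSq.zero, by simp⟩
  add_mem' := by
    rintro _ _ ⟨m, hm, s, hs, rfl⟩ ⟨n, hn, t, ht, rfl⟩
    exact ⟨m + n, add_mem hm hn, s + t, hs.add ht, by ring⟩

omit [Algebra ℝ A] in
theorem IsQuadraticModule.le_adjoin (h : IsQuadraticModule M) (a : A) : M ≤ h.adjoin a :=
  fun m hm => ⟨m, hm, 0, IsSumSq.zero, by simp⟩

omit [Algebra ℝ A] in
theorem IsQuadraticModule.mem_adjoin_self (h : IsQuadraticModule M) (a : A) : a ∈ h.adjoin a :=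
  ⟨0, zero_mem _, 1 * 1, IsSumSq.mul_self 1, by simp⟩

omit [Algebra ℝ A] in
theorem IsQuadraticModule.isQuadraticModule_adjoin (h : IsQuadraticModule M) (a : A) :
    IsQuadraticModule (h.adjoin a) where
  one_mem := h.le_adjoin a h.one_mem
  mul_self_mul_mem := by
    rintro b _ ⟨m, hm, s, hs, rfl⟩
    exact ⟨b * b * m, h.mul_self_mul_mem b m hm, b * b * s, (IsSumSq.mul_self b).mul hs, by ring⟩

omit [Algebra ℝ A] in
theorem exists_maximal_isQuadraticModule (h : IsQuadraticModule M) (hM : -1 ∉ M) :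
    ∃ S, M ≤ S ∧ Maximal (fun S => IsQuadraticModule S ∧ -1 ∉ S) S := by
  refine zorn_le_nonempty₀ {S : AddSubmonoid A | IsQuadraticModule S ∧ -1 ∉ S}
    (fun c hc hchain y hy => ?_) M
    ⟨h, hM⟩
  have hmem : ∀ {x}, x ∈ sSup c ↔ ∃ P ∈ c, x ∈ P :=
    AddSubmonoid.mem_sSup_of_directedOn ⟨y, hy⟩ hchain.directedOn
  refine ⟨sSup c, ⟨⟨hmem.2 ⟨y, hy, (hc hy).1.one_mem⟩, fun a m hm => ?_⟩, fun h => ?_⟩,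
    fun z hz => le_sSup hz⟩
  · obtain ⟨P, hP, hm⟩ := hmem.1 hm
    exact hmem.2 ⟨P, hP, (hc hP).1.mul_self_mul_mem a m hm⟩
  · obtain ⟨P, hP, h⟩ := hmem.1 h
    exact (hc hP).2 h

/-- `4ba = (b + 1)² a + (b - 1)² (-a)`; thus `M ∩ -M` is an ideal. -/
theorem IsQuadraticModule.mul_mem_of_neg_mem (h : IsQuadraticModule M) {a : A} (ha : a ∈ M)
    (hna : -a ∈ M) (b : A) : b * a ∈ M := by
  have h1 := h.mul_self_mul_mem (b + 1) a ha
  have h2 := h.mul_self_mul_mem (b - 1) (-a) hna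
  have h3 := h.algebraMap_mul_mem (r := 1 / 4) (by norm_num) (add_mem h1 h2)
  have h4 : algebraMap ℝ A (1 / 4) * 4 = 1 := by
    rw [← map_ofNat (algebraMap ℝ A) 4, ← map_mul]; norm_num
  convert h3 using 1
  linear_combination -b * a * h4

/-- Otherwise `-1 = m + s a = n - t a` with `s`, `t` sums of squares. Then `-s = tm + sn + t` is in
`M`, so `s` lies in the ideal `M ∩ -M`, as does `s a`, and `-1 ∈ M`. -/
theorem mem_or_neg_mem_of_maximal_isQuadraticModule
    (hM : Maximal (fun S => IsQuadraticModule S ∧ -1 ∉ S) M) (a : A) : a ∈ M ∨ -a ∈ M := by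
  have h := hM.prop.1
  have key : ∀ b, b ∉ M → ∃ m ∈ M, ∃ s, IsSumSq s ∧ -1 = m + s * b := by
    intro b hb
    by_contra hn
    exact hb (hM.le_of_ge ⟨h.isQuadraticModule_adjoin b, hn⟩ (h.le_adjoin b) (h.mem_adjoin_self b))
  by_contra! hn
  obtain ⟨m, hm, s, hs, h1⟩ := key a hn.1
  obtain ⟨n, hn, t, ht, h2⟩ := key (-a) hn.2
  have h3 : -s ∈ M := by
    have := add_mem (add_mem (h.sumSq_mul_mem ht hm) (h.sumSq_mul_mem hs hn)) (h.sumSq_mem ht)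
    convert this using 1
    linear_combination t * h1 + s * h2
  apply hM.prop.2
  rw [h1, mul_comm]
  exact add_mem hm (h.mul_mem_of_neg_mem (h.sumSq_mem hs) h3 a)

theorem nonneg_of_algebraMap_mem (h : IsQuadraticModule M) (hM : -1 ∉ M) {r : ℝ}
    (hr : algebraMap ℝ A r ∈ M) : 0 ≤ r := by
  by_contra! hn
  apply hM
  have := h.algebraMap_mul_mem (r := (-r)⁻¹) (by simpa using hn.le) hr
  rwa [← map_mul, inv_neg, neg_mul, inv_mul_cancel₀ hn.ne, map_neg, map_one] at this

/-- The elements that are infinitesimal with respect to a quadratic module. -/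
def infinitesimals (M : AddSubmonoid A) : Set A :=
  {a | ∀ ε : ℝ, 0 < ε → algebraMap ℝ A ε + a ∈ M ∧ algebraMap ℝ A ε - a ∈ M}

theorem add_mem_infinitesimals {a b : A} (ha : a ∈ infinitesimals M) (hb : b ∈ infinitesimals M) :
    a + b ∈ infinitesimals M := by
  intro ε hε
  have h1 := ha (ε / 2) (by positivity)
  have h2 := hb (ε / 2) (by positivity)
  have h3 : algebraMap ℝ A ε = algebraMap ℝ A (ε / 2) + algebraMap ℝ A (ε / 2) := by
    rw [← map_add, add_halves]
  constructor
  · convert add_mem h1.1 h2.1 using 1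
    rw [h3]; ring
  · convert add_mem h1.2 h2.2 using 1
    rw [h3]; ring

theorem neg_mem_infinitesimals {a : A} (ha : a ∈ infinitesimals M) : -a ∈ infinitesimals M :=
  fun ε hε => ⟨by simpa [sub_eq_add_neg] using (ha ε hε).2, by simpa using (ha ε hε).1⟩

theorem IsQuadraticModule.algebraMap_mul_mem_infinitesimals (h : IsQuadraticModule M) (r : ℝ)
    {a : A} (ha : a ∈ infinitesimals M) : algebraMap ℝ A r * a ∈ infinitesimals M := by
  wlog hr : 0 < r generalizing r
  · rcases (not_lt.1 hr).eq_or_lt with rfl | hr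
    · intro ε hε
      simpa using h.algebraMap_mem hε.le
    · have := neg_mem_infinitesimals (this (-r) (neg_pos.2 hr))
      simpa using this
  intro ε hε
  have h1 := ha (ε / r) (by positivity)
  have h2 : algebraMap ℝ A ε = algebraMap ℝ A r * algebraMap ℝ A (ε / r) := by
    rw [← map_mul, mul_div_cancel₀ _ hr.ne']
  rw [h2, ← mul_add, ← mul_sub]
  exact ⟨h.algebraMap_mul_mem hr.le h1.1, h.algebraMap_mul_mem hr.le h1.2⟩

/-- For `ε = δ²`: `2δ(δ² - a²) = (δ - a)²(δ + a) + (δ + a)²(δ - a)`. Polarization then handles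
products. -/
theorem IsQuadraticModule.mul_self_mem_infinitesimals (h : IsQuadraticModule M) {a : A}
    (ha : a ∈ infinitesimals M) : a * a ∈ infinitesimals M := by
  intro ε hε
  refine ⟨add_mem (h.algebraMap_mem hε.le) (h.mul_self_mem a), ?_⟩
  obtain ⟨δ, hδ, rfl⟩ : ∃ δ > 0, ε = δ * δ :=
    ⟨√ε, Real.sqrt_pos.2 hε, (Real.mul_self_sqrt hε.le).symm⟩
  have h1 := ha δ hδ
  have h2 := add_mem (h.mul_self_mul_mem (algebraMap ℝ A δ - a) _ h1.1)
    (h.mul_self_mul_mem (algebraMap ℝ A δ + a) _ h1.2)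
  have h3 := h.algebraMap_mul_mem (r := (2 * δ)⁻¹) (by positivity) h2
  have h4 : algebraMap ℝ A (2 * δ)⁻¹ * (2 * algebraMap ℝ A δ) = 1 := by
    rw [← map_ofNat (algebraMap ℝ A) 2, ← map_mul, ← map_mul, inv_mul_cancel₀ (by positivity),
      map_one]
  convert h3 using 1
  rw [map_mul]
  linear_combination -(algebraMap ℝ A δ * algebraMap ℝ A δ - a * a) * h4

theorem IsQuadraticModule.mul_mem_infinitesimals_of_mem (h : IsQuadraticModule M) {a b : A}
    (ha : a ∈ infinitesimals M) (hb : b ∈ infinitesimals M) : a * b ∈ infinitesimals M := by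
  have h1 := add_mem_infinitesimals (h.mul_self_mem_infinitesimals (add_mem_infinitesimals ha hb))
    (neg_mem_infinitesimals (add_mem_infinitesimals (h.mul_self_mem_infinitesimals ha)
      (h.mul_self_mem_infinitesimals hb)))
  have h2 := h.algebraMap_mul_mem_infinitesimals (1 / 2) h1
  have h3 : algebraMap ℝ A (1 / 2) * 2 = 1 := by
    rw [← map_ofNat (algebraMap ℝ A) 2, ← map_mul]; norm_num
  convert h2 using 1
  linear_combination -(a * b) * h3

/-- The standard part of `a` is the supremum of the reals `r` with `a - r ∈ M`. This set is a cut
because `M` contains one of every element and its negative. -/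
theorem exists_sub_mem_infinitesimals (hM : Maximal (fun S => IsQuadraticModule S ∧ -1 ∉ S) M)
    (harch : ∀ a, ∃ k : ℝ, algebraMap ℝ A k - a ∈ M) (a : A) :
    ∃ r : ℝ, a - algebraMap ℝ A r ∈ infinitesimals M := by
  obtain ⟨h, hM1⟩ := hM.prop
  let B : Set ℝ := {r | a - algebraMap ℝ A r ∈ M}
  have hne : B.Nonempty := by
    obtain ⟨k, hk⟩ := harch (-a)
    exact ⟨-k, by simpa [B, add_comm] using hk⟩
  have hbdd : BddAbove B := by
    obtain ⟨k, hk⟩ := harch a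
    refine ⟨k, fun r hr => ?_⟩
    have := add_mem hk hr
    rw [sub_add_sub_cancel, ← map_sub] at this
    exact sub_nonneg.1 (nonneg_of_algebraMap_mem h hM1 this)
  refine ⟨sSup B, fun ε hε => ⟨?_, ?_⟩⟩
  · obtain ⟨r, hr, hr'⟩ := exists_lt_of_lt_csSup hne (show sSup B - ε < sSup B by linarith)
    convert add_mem hr (h.algebraMap_mem (r := r - sSup B + ε) (by linarith)) using 1
    simp only [map_add, map_sub]
    ring
  · have h1 : sSup B + ε / 2 ∉ B := fun hm => by
      have := le_csSup hbdd hm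
      linarith
    have h2 := (mem_or_neg_mem_of_maximal_isQuadraticModule hM
      (a - algebraMap ℝ A (sSup B + ε / 2))).resolve_left h1
    convert add_mem h2 (h.algebraMap_mem (r := ε / 2) (by linarith)) using 1
    rw [show algebraMap ℝ A ε = algebraMap ℝ A (ε / 2) + algebraMap ℝ A (ε / 2) by
      rw [← map_add, add_halves]]
    simp only [map_add]
    ring

/-- An archimedean maximal proper quadratic module is non-negative at a real point. -/
theorem exists_algHom_of_maximal (hM : Maximal (fun S => IsQuadraticModule S ∧ -1 ∉ S) M)
    (harch : ∀ a, ∃ k : ℝ, algebraMap ℝ A k - a ∈ M) :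
    ∃ α : A →ₐ[ℝ] ℝ, ∀ s ∈ M, 0 ≤ α s := by
  obtain ⟨h, hM1⟩ := hM.prop
  let J : Ideal A :=
    { carrier := infinitesimals M
      add_mem' := add_mem_infinitesimals
      zero_mem' := fun ε hε => by simpa using h.algebraMap_mem hε.le
      smul_mem' := fun c a ha => by
        obtain ⟨r, hr⟩ := exists_sub_mem_infinitesimals hM harch c
        have := add_mem_infinitesimals (h.algebraMap_mul_mem_infinitesimals r ha)
          (h.mul_mem_infinitesimals_of_mem hr ha)
        rwa [← add_mul, add_sub_cancel] at this }
  have hJ : ∀ r : ℝ, algebraMap ℝ A r ∈ J → r = 0 := by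
    intro r hr
    refine le_antisymm (le_of_forall_pos_le_add fun ε hε => ?_)
      (le_of_forall_pos_le_add fun ε hε => ?_)
    · have := (hr ε hε).2
      rw [← map_sub] at this
      linarith [nonneg_of_algebraMap_mem h hM1 this]
    · have := (hr ε hε).1
      rw [← map_add] at this
      linarith [nonneg_of_algebraMap_mem h hM1 this]
  have hbij : Function.Bijective (Algebra.ofId ℝ (A ⧸ J)) := by
    constructor
    · rw [injective_iff_map_eq_zero]
      intro r hr
      exact hJ r (Ideal.Quotient.eq_zero_iff_mem.1 hr)
    · intro y
      obtain ⟨a, rfl⟩ := Ideal.Quotient.mk_surjective y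
      obtain ⟨r, hr⟩ := exists_sub_mem_infinitesimals hM harch a
      exact ⟨r, (Ideal.Quotient.eq.2 hr).symm⟩
  -- Modulo the ideal of infinitesimals only standard parts remain, so the quotient is `ℝ`.
  let e := AlgEquiv.ofBijective (Algebra.ofId ℝ (A ⧸ J)) hbij
  refine ⟨(e.symm : (A ⧸ J) →ₐ[ℝ] ℝ).comp (Ideal.Quotient.mkₐ ℝ J), fun s hs => ?_⟩
  obtain ⟨r, hr⟩ := exists_sub_mem_infinitesimals hM harch s
  have h1 : Ideal.Quotient.mk J s = e r := Ideal.Quotient.eq.2 hr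
  have h2 : ((e.symm : (A ⧸ J) →ₐ[ℝ] ℝ).comp (Ideal.Quotient.mkₐ ℝ J)) s = r := by
    change e.symm (Ideal.Quotient.mk J s) = r
    rw [h1, AlgEquiv.symm_apply_apply]
  rw [h2]
  refine le_of_forall_pos_le_add fun ε hε => nonneg_of_algebraMap_mem h hM1 ?_
  convert add_mem (hr ε hε).2 hs using 1
  rw [map_add]
  ring

/-- Jacobi's representation theorem. -/
theorem IsQuadraticModule.mem_of_forall_pos (h : IsQuadraticModule M)
    (harch : ∀ a, ∃ k : ℝ, algebraMap ℝ A k - a ∈ M) {f : A}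
    (hf : ∀ α : A →ₐ[ℝ] ℝ, (∀ m ∈ M, 0 ≤ α m) → 0 < α f) : f ∈ M := by
  -- Otherwise some real point of `M` would have `f ≤ 0`. The result is `s f - 1 ∈ M` with `s` a sum
  -- of squares, and `s` must now be removed.
  obtain ⟨m, hm, s, hs, hms⟩ : -1 ∈ h.adjoin (-f) := by
    by_contra hn
    obtain ⟨S, hMS, hS⟩ := exists_maximal_isQuadraticModule (h.isQuadraticModule_adjoin (-f)) hn
    have hle := (h.le_adjoin (-f)).trans hMS
    obtain ⟨α, hα⟩ := exists_algHom_of_maximal hS fun a => (harch a).imp fun k hk => hle hk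
    have h1 := hf α fun m hm => hα m (hle hm)
    have h2 := hα (-f) (hMS (h.mem_adjoin_self _))
    rw [map_neg] at h2
    linarith
  have hsf : s * f - 1 ∈ M := by
    convert hm using 1
    linear_combination hms
  obtain ⟨k₁, hk₁⟩ := harch s
  obtain ⟨k₂, hk₂⟩ := harch (1 + s * s * f)
  let k : ℝ := max 1 (max k₁ k₂)
  have hk : 0 < k := lt_max_of_lt_left one_pos
  have h1 := h.algebraMap_sub_mem_of_le (s := 2 * k)
    (by linarith [le_max_left k₁ k₂, le_max_right 1 (max k₁ k₂)]) hk₁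
  have h2 := h.algebraMap_sub_mem_of_le (s := 2 * k)
    (by linarith [le_max_right k₁ k₂, le_max_right 1 (max k₁ k₂)]) hk₂
  have h12 : s * (algebraMap ℝ A (2 * k) - s) ∈ M := h.sumSq_mul_mem hs h1
  -- `k²(f + r) - 1 = (k - s)²(f + r) + 2k(s f - 1) + (2k - 1 - s² f) + r s(2k - s)`. So `r` drops
  -- by the fixed amount `1/k²`.
  have step : ∀ r : ℝ, 0 ≤ r → f + algebraMap ℝ A r ∈ M →
      f + algebraMap ℝ A (r - (k * k)⁻¹) ∈ M := by
    intro r hr hfr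
    have e := add_mem (add_mem (add_mem (h.mul_self_mul_mem (algebraMap ℝ A k - s) _ hfr)
      (h.algebraMap_mul_mem (r := 2 * k) (by positivity) hsf)) h2) (h.algebraMap_mul_mem hr h12)
    have e2 := h.algebraMap_mul_mem (r := (k * k)⁻¹) (by positivity) e
    have e3 : algebraMap ℝ A (k * k)⁻¹ * (algebraMap ℝ A k * algebraMap ℝ A k) = 1 := by
      rw [← map_mul, ← map_mul, inv_mul_cancel₀ (by positivity), map_one]
    convert e2 using 1
    simp only [map_sub, map_mul, map_ofNat]
    linear_combination -(f + algebraMap ℝ A r) * e3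
  obtain ⟨r, hr⟩ := harch (-f)
  -- The constant is truncated at `0` because `step` needs `r ≥ 0`; it reaches `0` after finitely
  -- many steps.
  have iter : ∀ n : ℕ, f + algebraMap ℝ A (max (r - n * (k * k)⁻¹) 0) ∈ M := by
    intro n
    induction n with
    | zero =>
      convert add_mem hr (h.algebraMap_mem (r := max r 0 - r) (by linarith [le_max_left r 0]))
        using 1
      simp only [Nat.cast_zero, zero_mul, sub_zero, map_sub]
      ring
    | succ n ih =>
      have e := step _ (le_max_right _ _) ih
      have hle : max (r - n * (k * k)⁻¹) 0 - (k * k)⁻¹ ≤ max (r - (n + 1 : ℕ) * (k * k)⁻¹) 0 := by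
        have : 0 < (k * k)⁻¹ := by positivity
        rw [← max_sub_sub_right, zero_sub]
        refine max_le_max ?_ (by linarith)
        push_cast
        linarith
      convert add_mem e (h.algebraMap_mem (sub_nonneg.2 hle)) using 1
      rw [add_assoc, ← map_add, add_sub_cancel]
  obtain ⟨n, hn⟩ := exists_nat_ge (r * (k * k))
  have := iter n
  rwa [max_eq_right, map_zero, add_zero] at this
  rw [sub_nonpos, ← div_eq_mul_inv, le_div_iff₀ (by positivity)]
  exact hn

end QuadraticModule

theorem isSumSq_map {A B : Type*} [CommRing A] [CommRing B] (φ : A →+* B) {s : A}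
    (hs : IsSumSq s) : IsSumSq (φ s) := by
  induction hs with
  | zero => simp
  | sq_add a _ ih => rw [map_add, map_mul]; exact IsSumSq.sq_add _ ih

theorem mul_self_mem_sumSq {A : Type*} [CommRing A] (x : A) : x * x ∈ Subsemiring.sumSq A := by
  simp

theorem isQuadraticModule_of_mul_self_mem {A : Type*} [CommRing A] {T : Subsemiring A}
    (hT : ∀ x, x * x ∈ T) : IsQuadraticModule T.toAddSubmonoid :=
  ⟨T.one_mem, fun a _ hm => T.mul_mem (hT a) hm⟩

theorem le_adjoinElement {A : Type*} [CommRing A] (P : Subsemiring A) (x : A) (hx : x * x ∈ P) :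
    P ≤ adjoinElement P x hx := fun y hy => ⟨y, hy, 0, zero_mem _, by simp⟩

theorem mem_adjoinElement_self {A : Type*} [CommRing A] (P : Subsemiring A) (x : A)
    (hx : x * x ∈ P) : x ∈ adjoinElement P x hx := ⟨0, zero_mem _, 1, one_mem _, by simp⟩

/-! ### From compactness to the archimedean property (Schmüdgen, Wörmann) -/

section Archimedean

open MvPolynomial

variable {σ : Type*} [Fintype σ]

/-- If `(1 + t) (N - |X|²)` lies in a preordering for some `t` in it, then the preordering is
archimedean. -/
theorem exists_sub_sum_sq_mem {T : Subsemiring (MvPolynomial σ ℝ)} (hT : ∀ x, x * x ∈ T) {N : ℝ}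
    (hN : 0 ≤ N) {t : MvPolynomial σ ℝ} (ht : t ∈ T)
    (h : (1 + t) * (C N - ∑ i, X i * X i) ∈ T) :
    ∃ N' : ℝ, C N' - ∑ i, X i * X i ∈ T := by
  have hTq := isQuadraticModule_of_mul_self_mem hT
  set g : MvPolynomial σ ℝ := C N - ∑ i, X i * X i with hg
  let Q := adjoinElement (Subsemiring.sumSq (MvPolynomial σ ℝ)) g (mul_self_mem_sumSq g)
  have hQ : ∀ x, x * x ∈ Q := fun x => le_adjoinElement _ _ _ (mul_self_mem_sumSq x)
  -- `ΣA² + g ΣA²` contains `g = N - |X|²`, so it is archimedean and bounds `t`: `k - t = a + g b`.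
  obtain ⟨k, a, ha, b, hb, hab⟩ :=
    (isQuadraticModule_of_mul_self_mem hQ).exists_sub_mem_of_mvPolynomial
      (mem_adjoinElement_self _ g (mul_self_mem_sumSq g)) t
  have haT : a ∈ T := hTq.sumSq_mem (by simpa using ha)
  have hbT : b ∈ T := hTq.sumSq_mem (by simpa using hb)
  have h1 : (1 + t) * (C k - t) ∈ T := by
    rw [hab, mul_add]
    refine add_mem (mul_mem (add_mem (one_mem _) ht) haT) ?_
    rw [show (1 + t) * (g * b) = b * ((1 + t) * g) by ring]
    exact mul_mem hbT h
  -- `(1 + t)(k - t) + (t - k/2)² = k + k²/4 - t`.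
  have h2 : C (k + k / 2 * (k / 2)) - t ∈ T := by
    have hk : (C (k / 2) : MvPolynomial σ ℝ) * 2 = C k := by
      rw [← map_ofNat C 2, ← map_mul, div_mul_cancel₀ k two_ne_zero]
    convert add_mem h1 (hT (t - C (k / 2))) using 1
    rw [map_add, map_mul]
    linear_combination t * hk
  -- With `k' = k + k²/4`: `N k' + N - |X|² = N(k' - t) + (1 + t) g + t |X|²`.
  refine ⟨N * (k + k / 2 * (k / 2)) + N, ?_⟩
  have h3 : _ ∈ T := add_mem (add_mem (hTq.algebraMap_mul_mem hN h2 : _ ∈ T) h)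
    (mul_mem ht (sum_mem fun i (_ : i ∈ Finset.univ) => hT (X i)))
  convert h3 using 1
  rw [map_add, map_mul, algebraMap_eq, hg]
  ring

/-- If `{q ≥ 0}` is compact, then the preordering generated by `q` is archimedean. -/
theorem exists_sub_sum_sq_mem_of_isCompact {n : ℕ} (q : MvPolynomial (Fin n) ℝ)
    (hq : IsCompact {x : Fin n → ℝ | 0 ≤ eval x q}) :
    ∃ (N : ℝ) (s t : MvPolynomial (Fin n) ℝ), IsSumSq s ∧ IsSumSq t ∧
      C N - ∑ i, X i * X i = s + q * t := by
  obtain ⟨B, hB⟩ := hq.bddAbove_image (f := fun x : Fin n → ℝ => ∑ i, x i * x i)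
    (by fun_prop)
  -- Strictly larger than `|x|²` on `{q ≥ 0}`, so `q ≥ 0` and `-g ≥ 0` have no common real point.
  set N : ℝ := max B 0 + 1 with hN
  have hN0 : 0 ≤ N := by positivity
  set g : MvPolynomial (Fin n) ℝ := C N - ∑ i, X i * X i with hg
  let T := adjoinElement (Subsemiring.sumSq (MvPolynomial (Fin n) ℝ)) q (mul_self_mem_sumSq q)
  have hT : ∀ x, x * x ∈ T := fun x => le_adjoinElement _ _ _ (mul_self_mem_sumSq x)
  let T' := adjoinElement T (-g) (hT _)
  have hT' : ∀ x, x * x ∈ T' := fun x => le_adjoinElement _ _ _ (hT x)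
  have hneg : -1 ∈ T' := by
    classical
    by_contra hn
    obtain ⟨x, hx⟩ := exists_real_point T' hT' hn {q, -g} (by
      intro p hp
      simp only [Finset.mem_insert, Finset.mem_singleton] at hp
      rcases hp with rfl | rfl
      · exact le_adjoinElement _ _ _ (mem_adjoinElement_self _ _ _)
      · exact mem_adjoinElement_self _ _ _)
    have h1 := hx q (by simp)
    have h2 := hx (-g) (by simp)
    have h3 : ∑ i, x i * x i ≤ B := hB ⟨x, h1, rfl⟩
    simp only [hg, map_neg, map_sub, eval_C, map_sum, map_mul, eval_X] at h2
    have := le_max_left B 0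
    linarith
  -- `-1 = a - g b` gives `(1 + a) g = g² b`, an element of `T`.
  obtain ⟨a, ha, b, hb, hab⟩ := hneg
  obtain ⟨N', s, hs, t, ht, hst⟩ := exists_sub_sum_sq_mem hT hN0 ha (by
    have : (1 + a) * (C N - ∑ i, X i * X i) = g * g * b := by
      rw [← hg]
      linear_combination -g * hab
    rw [this]
    exact mul_mem (hT g) hb)
  exact ⟨N', s, t, by simpa using hs, by simpa using ht, hst⟩

end Archimedean

/-! ### The quadratic module of the certificate and its real points -/

section Certificate

open MvPolynomial

variable {n l : ℕ}

/-- The quadratic module of `ℝ[X, W]` generated by the `q_i` and by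
`± (|W|² - 1)`, `± Wᵀ f`. -/
def certificateModule (f : Fin n → MvPolynomial (Fin n) ℝ)
    (q : Fin l → MvPolynomial (Fin n) ℝ) : AddSubmonoid (PolyXW n) where
  carrier := {p | ∃ (s₀ : PolyXW n) (s : Fin l → PolyXW n) (p₁ p₂ : PolyXW n),
    IsSumSq s₀ ∧ (∀ i, IsSumSq (s i)) ∧
      p = s₀ + ∑ i, s i * liftX (q i) + p₁ * (vecW n ⬝ᵥ vecW n - 1)
        + p₂ * (vecW n ⬝ᵥ fun i => liftX (f i))}
  zero_mem' := ⟨0, 0, 0, 0, IsSumSq.zero, fun _ => IsSumSq.zero, by simp⟩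
  add_mem' := by
    rintro _ _ ⟨s₀, s, p₁, p₂, h₀, h, rfl⟩ ⟨t₀, t, r₁, r₂, k₀, k, rfl⟩
    refine ⟨s₀ + t₀, s + t, p₁ + r₁, p₂ + r₂, h₀.add k₀, fun i => (h i).add (k i), ?_⟩
    simp only [Pi.add_apply, add_mul, Finset.sum_add_distrib]
    ring

variable (f : Fin n → MvPolynomial (Fin n) ℝ) (q : Fin l → MvPolynomial (Fin n) ℝ)

theorem isQuadraticModule_certificateModule : IsQuadraticModule (certificateModule f q) where
  one_mem := ⟨1 * 1, 0, 0, 0, IsSumSq.mul_self 1, fun _ => IsSumSq.zero, by simp⟩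
  mul_self_mul_mem := by
    rintro a _ ⟨s₀, s, p₁, p₂, h₀, h, rfl⟩
    refine ⟨a * a * s₀, fun i => a * a * s i, a * a * p₁, a * a * p₂,
      (IsSumSq.mul_self a).mul h₀, fun i => (IsSumSq.mul_self a).mul (h i), ?_⟩
    simp only [mul_add, Finset.mul_sum, mul_assoc]

theorem isSumSq_liftX {s : MvPolynomial (Fin n) ℝ} (hs : IsSumSq s) : IsSumSq (liftX s) :=
  isSumSq_map liftX.toRingHom hs

theorem liftX_mem_certificateModule {p : MvPolynomial (Fin n) ℝ} (hp : p ∈ quadraticModule q) :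
    liftX p ∈ certificateModule f q := by
  obtain ⟨s₀, s, h₀, h, rfl⟩ := hp
  exact ⟨liftX s₀, fun i => liftX (s i), 0, 0, isSumSq_liftX h₀, fun i => isSumSq_liftX (h i),
    by simp⟩

/-- `N - |X|²` comes from the compact set `{p ≥ 0}` and `1 - |W|²` from the generators. Their sum
bounds all the variables. -/
theorem certificateModule_archimedean (hq : ∃ p ∈ quadraticModule q,
    IsCompact {x : Fin n → ℝ | 0 ≤ eval x p}) (a : PolyXW n) :
    ∃ k : ℝ, C k - a ∈ certificateModule f q := by
  obtain ⟨p, hp, hc⟩ := hq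
  obtain ⟨N, s, t, hs, ht, hst⟩ := exists_sub_sum_sq_mem_of_isCompact p hc
  have hM := isQuadraticModule_certificateModule f q
  refine hM.exists_sub_mem_of_mvPolynomial (N := N + 1) ?_ a
  have h1 : liftX (s + p * t) ∈ certificateModule f q := by
    rw [map_add, map_mul, mul_comm]
    exact add_mem (hM.sumSq_mem (isSumSq_liftX hs))
      (hM.sumSq_mul_mem (isSumSq_liftX ht) (liftX_mem_certificateModule f q hp))
  have h2 : 1 - vecW n ⬝ᵥ vecW n ∈ certificateModule f q :=
    ⟨0, 0, -1, 0, IsSumSq.zero, fun _ => IsSumSq.zero, by simp⟩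
  rw [← hst] at h1
  convert add_mem h1 h2 using 1
  simp [liftX, vecW, dotProduct]
  ring

theorem eval_liftX (x w : Fin n → ℝ) (p : MvPolynomial (Fin n) ℝ) :
    eval (Sum.elim x w) (liftX p) = eval x p := by
  simp [liftX, eval_rename]

theorem eval_quadratic (x w : Fin n → ℝ) (A : Matrix (Fin n) (Fin n) (MvPolynomial (Fin n) ℝ)) :
    eval (Sum.elim x w) (vecW n ⬝ᵥ (A.map liftX *ᵥ vecW n)) = w ⬝ᵥ (evalMatrix x A *ᵥ w) := by
  simp [dotProduct, Matrix.mulVec, vecW, evalMatrix, eval_liftX]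

theorem eval_norm (x w : Fin n → ℝ) :
    eval (Sum.elim x w) (vecW n ⬝ᵥ vecW n) = w ⬝ᵥ w := by
  simp [dotProduct, vecW]

theorem eval_normal (x w : Fin n → ℝ) :
    eval (Sum.elim x w) (vecW n ⬝ᵥ fun i => liftX (f i)) = w ⬝ᵥ fun i => eval x (f i) := by
  simp [dotProduct, vecW, eval_liftX]

/-- The real points over which the quadratic form is to be estimated. -/
def normalBundle : Set ((Fin n → ℝ) × (Fin n → ℝ)) :=
  {z | z.1 ∈ semialgSet q ∧ z.2 ∈ unitNormals f z.1}

theorem isCompact_normalBundle (hq : ∃ p ∈ quadraticModule q,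
    IsCompact {x : Fin n → ℝ | 0 ≤ eval x p}) : IsCompact (normalBundle f q) := by
  obtain ⟨p, ⟨s₀, s, h₀, h, rfl⟩, hc⟩ := hq
  have hball : IsCompact {w : Fin n → ℝ | ∀ i, w i ∈ Set.Icc (-1 : ℝ) 1} := by
    have := isCompact_univ_pi (fun _ : Fin n => isCompact_Icc (a := (-1 : ℝ)) (b := 1))
    simpa [Set.pi] using this
  refine (hc.prod hball).of_isClosed_subset ?_ ?_
  · have h1 : IsClosed {z : (Fin n → ℝ) × (Fin n → ℝ) | ∀ i, 0 ≤ eval z.1 (q i)} := by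
      simp only [Set.ofPred_forall]
      exact isClosed_iInter fun i => isClosed_le continuous_const
        ((MvPolynomial.continuous_eval (q i)).comp continuous_fst)
    have h2 : IsClosed {z : (Fin n → ℝ) × (Fin n → ℝ) | z.2 ⬝ᵥ z.2 = 1} :=
      isClosed_eq (by fun_prop) continuous_const
    have h3 : IsClosed {z : (Fin n → ℝ) × (Fin n → ℝ) |
        (z.2 ⬝ᵥ fun i => eval z.1 (f i)) = 0} := by
      refine isClosed_eq ?_ continuous_const
      unfold dotProduct
      exact continuous_finsetSum _ fun i _ => ((continuous_apply i).comp continuous_snd).mul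
        ((MvPolynomial.continuous_eval (f i)).comp continuous_fst)
    exact h1.inter (h2.inter h3)
  · rintro ⟨x, w⟩ ⟨hx, hw1, -⟩
    refine ⟨?_, fun i => ?_⟩
    · simp only [Set.mem_ofPred_eq, map_add, map_sum, map_mul]
      exact add_nonneg (isSumSq_map (eval x) h₀).nonneg
        (Finset.sum_nonneg fun i _ => mul_nonneg (isSumSq_map (eval x) (h i)).nonneg (hx i))
    · have h1 : w i * w i ≤ 1 := by
        rw [← hw1]
        exact Finset.single_le_sum (f := fun i => w i * w i) (fun j _ => mul_self_nonneg _)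
          (Finset.mem_univ i)
      exact abs_le.1 (abs_le_one_iff_mul_self_le_one.2 h1)

theorem continuous_neg_quadratic (A : Matrix (Fin n) (Fin n) (MvPolynomial (Fin n) ℝ)) :
    Continuous fun z : (Fin n → ℝ) × (Fin n → ℝ) => -(z.2 ⬝ᵥ (evalMatrix z.1 A *ᵥ z.2)) := by
  have h := (MvPolynomial.continuous_eval (vecW n ⬝ᵥ (A.map liftX *ᵥ vecW n))).comp
    (show Continuous fun z : (Fin n → ℝ) × (Fin n → ℝ) => Sum.elim z.1 z.2 from
      continuous_pi fun i => by cases i <;> simp only [Sum.elim_inl, Sum.elim_inr] <;> fun_prop)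
  simp only [Function.comp_def, eval_quadratic] at h
  exact h.neg

/-- An algebra map to `ℝ` is evaluation at a point. Generators occurring with both signs must vanish
there, which gives the two equations on `w`. -/
theorem exists_normalBundle_of_algHom (α : PolyXW n →ₐ[ℝ] ℝ)
    (hα : ∀ m ∈ certificateModule f q, 0 ≤ α m) :
    ∃ x w, (x, w) ∈ normalBundle f q ∧ ∀ p, α p = eval (Sum.elim x w) p := by
  have hα' : α = aeval (Sum.elim (fun i => α (X (Sum.inl i))) fun i => α (X (Sum.inr i))) := by
    refine algHom_ext fun i => ?_
    cases i <;> simp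
  have hev (p) : α p =
      eval (Sum.elim (fun i => α (X (Sum.inl i))) fun i => α (X (Sum.inr i))) p :=
    (DFunLike.congr_fun hα' p).trans (DFunLike.congr_fun (coe_aeval_eq_eval _) p)
  refine ⟨fun i => α (X (Sum.inl i)), fun i => α (X (Sum.inr i)), ?_, hev⟩
  have hzero : ∀ p, p ∈ certificateModule f q → -p ∈ certificateModule f q → α p = 0 :=
    fun p h1 h2 => le_antisymm (by simpa using hα _ h2) (hα _ h1)
  refine ⟨fun i => ?_, ?_, ?_⟩
  · classical
    have h1 := hα _ (liftX_mem_certificateModule f q (p := q i) ⟨0, Pi.single i (1 * 1),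
      IsSumSq.zero, fun j => by
        by_cases hj : j = i
        · subst hj; simp
        · simp [Pi.single_eq_of_ne hj], by simp [Pi.single_apply]⟩)
    rwa [hev, eval_liftX] at h1
  · have h1 := hzero (vecW n ⬝ᵥ vecW n - 1)
      ⟨0, 0, 1, 0, IsSumSq.zero, fun _ => IsSumSq.zero, by simp⟩
      ⟨0, 0, -1, 0, IsSumSq.zero, fun _ => IsSumSq.zero, by simp⟩
    rw [hev, map_sub, eval_norm, map_one, sub_eq_zero] at h1
    exact h1
  · have h1 := hzero (vecW n ⬝ᵥ fun i => liftX (f i))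
      ⟨0, 0, 0, 1, IsSumSq.zero, fun _ => IsSumSq.zero, by simp⟩
      ⟨0, 0, 0, -1, IsSumSq.zero, fun _ => IsSumSq.zero, by simp⟩
    rwa [hev, eval_normal] at h1

end Certificate

end PolyContraction

open PolyContraction in
theorem mainTheorem2 (n l : ℕ)
    (f : Fin n → MvPolynomial (Fin n) ℝ)
    (G : Matrix (Fin n) (Fin n) (MvPolynomial (Fin n) ℝ))
    (q : Fin l → MvPolynomial (Fin n) ℝ)
    (U : Set (Fin n → ℝ)) (hU : IsOpen U)
    (hKU : PolyContraction.semialgSet q ⊆ U)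
    (hG : PolyContraction.IsRiemannianMetricOn G U)
    (hq : ∃ p ∈ PolyContraction.quadraticModule q,
      IsCompact {x : Fin n → ℝ | 0 ≤ MvPolynomial.eval x p}) :
    (∀ x ∈ PolyContraction.semialgSet q, PolyContraction.lambdaPrime f G x < 0) ↔
      ∃ (ε : ℝ) (p₁ p₂ : PolyContraction.PolyXW n) (s : Fin l → PolyContraction.PolyXW n),
        0 < ε ∧ (∀ i, IsSumSq (s i)) ∧
          IsSumSq (PolyContraction.certificate f G q ε p₁ p₂ s) := by
  constructor
  · intro h
    have hpos : ∀ z ∈ normalBundle f q,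
        0 < -(z.2 ⬝ᵥ (evalMatrix z.1 (contractionMatrix f G) *ᵥ z.2)) := by
      rintro ⟨x, w⟩ ⟨hx, hw⟩
      have h1 := (le_iSup₂ (f := fun w (_ : w ∈ unitNormals f x) =>
        ((w ⬝ᵥ (evalMatrix x (contractionMatrix f G) *ᵥ w) : ℝ) : EReal)) w hw).trans_lt (h x hx)
      exact neg_pos.2 (by exact_mod_cast h1)
    -- A uniform bound over all of `K`, valid also when the bundle is empty; halving `δ` keeps
    -- strict positivity.
    obtain ⟨δ, hδ, hδ'⟩ := (isCompact_normalBundle f q hq).exists_forall_le'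
      (continuous_neg_quadratic (contractionMatrix f G)).continuousOn hpos
    have hM := isQuadraticModule_certificateModule f q
    have hmem : -MvPolynomial.C (δ / 2)
        - vecW n ⬝ᵥ ((contractionMatrix f G).map liftX *ᵥ vecW n) ∈ certificateModule f q := by
      refine hM.mem_of_forall_pos (certificateModule_archimedean f q hq) fun α hα => ?_
      obtain ⟨x, w, hxw, hev⟩ := exists_normalBundle_of_algHom f q α hα
      have := hδ' (x, w) hxw
      rw [hev]
      simp only [map_sub, map_neg, MvPolynomial.eval_C, eval_quadratic]
      linarith
    obtain ⟨s₀, s, p₁, p₂, h₀, hs, heq⟩ := hmem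
    -- The equality terms move to the other side, hence the signs.
    refine ⟨δ / 2, -p₁, -p₂, s, by positivity, hs, ?_⟩
    convert h₀ using 1
    rw [certificate, heq]
    ring
  · rintro ⟨ε, p₁, p₂, s, hε, hs, hcert⟩ x hx
    -- The uniform `-ε` makes the supremum itself negative, whether or not it is over an empty set.
    have hle : lambdaPrime f G x ≤ ((-ε : ℝ) : EReal) := by
      refine iSup₂_le fun w hw => EReal.coe_le_coe_iff.2 ?_
      have h1 := (isSumSq_map (MvPolynomial.eval (Sum.elim x w)) hcert).nonneg
      have h2 : 0 ≤ ∑ i, MvPolynomial.eval (Sum.elim x w) (s i) * MvPolynomial.eval x (q i) :=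
        Finset.sum_nonneg fun i _ => mul_nonneg (isSumSq_map _ (hs i)).nonneg (hx i)
      rw [certificate] at h1
      simp only [map_add, map_sub, map_neg, map_mul, map_sum, map_one, MvPolynomial.eval_C,
        eval_quadratic, eval_norm, eval_normal, eval_liftX, hw.1, hw.2] at h1
      linarith
    exact hle.trans_lt (by exact_mod_cast neg_neg_iff_pos.2 hε)
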